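/- **Theorem.** Let $\beta>0$. There is a real constant $c$, depending only on $\beta$, such that the following holds. For every $\mathsf{SNR}>0$ let $P,\sigma_N^2>0$ satisfy $P/\sigma_N^2=\mathsf{SNR}$ ($P$ and $\sigma_N^2$ may vary with $\mathsf{SNR}$), put $L=\lceil\beta\sqrt{\mathsf{SNR}}\,\rceil$ and $\Delta=1/L$, and consider the channel $$Y_k = X_{\lceil k/L\rceil}\,\Delta\, e^{j\Theta_k}+N_k,\qquad k=1,2,\dots,$$ where $(N_k)$ is i.i.d. circularly-symmetric complex Gaussian with mean $0$ and $\mathbb E|N_k|^2=\sigma_N^2\Delta$; $\Theta_1$ is uniform on $[-\pi,\pi)$ and $\Theta_{k+1}=\Theta_k+W_k$, where $(W_k)$ is i.i.d. real Gaussian with mean $0$ and variance $2\pi\beta\Delta$, independent of $\Theta_1$; and the input $(X_k)$, the noise $(N_k)$ and the phase process $(\Theta_k)$ are mutually independent. Let the input symbols $X_1,X_2,\dots$ be i.i.d. with $\arg(X_k)$ independent of $|X_k|$, $\arg(X_k)$ uniform on $[-\pi,\pi)$, and $|X_k|^2-P/2$ exponentially distributed with mean $P/2$. Write $X^n=(X_1,\dots,X_n)$,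 $\boldsymbol Y_k=(Y_{(k-1)L+1},\dots,Y_{kL})$, $\boldsymbol Y^n=(\boldsymbol Y_1,\dots,\boldsymbol Y_n)$. Then for every $\mathsf{SNR}>0$ the information rate $$I(X;\boldsymbol Y)=\lim_{n\to\infty}\frac1n I(X^n;\boldsymbol Y^n)$$ exists as a finite real number (mutual information in nats), and $$\liminf_{\mathsf{SNR}\to\infty}\Bigl[I(X;\boldsymbol Y)-\tfrac34\log\mathsf{SNR}\Bigr]\ \ge\ c .$$ -/

import Mathlib

open MeasureTheory ProbabilityTheory Filter Topology
open scoped ENNReal NNReal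

namespace WienerPhaseNoise

/-- The mutual information `I(A;B)` in nats of two random elements `A`, `B`: the Kullback-Leibler
divergence of the joint law of `(A, B)` from the product of the two marginal laws. -/
noncomputable def mutualInfo {Ω S T : Type*} [MeasurableSpace Ω] [MeasurableSpace S]
    [MeasurableSpace T] (μ : Measure Ω) (A : Ω → S) (B : Ω → T) : ℝ≥0∞ :=
  InformationTheory.klDiv (μ.map (fun ω => (A ω, B ω))) ((μ.map A).prod (μ.map B))

/-- The circularly-symmetric complex Gaussian law with mean `0` and `E|Z|² = v`: real and
imaginary parts are independent real Gaussians of mean `0` and variance `v / 2`. -/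
noncomputable def complexGaussian (v : ℝ) : Measure ℂ :=
  ((gaussianReal 0 (v / 2).toNNReal).prod (gaussianReal 0 (v / 2).toNNReal)).map
    (fun p : ℝ × ℝ => (⟨p.1, p.2⟩ : ℂ))

/-- The uniform law on `[-π, π)`. -/
noncomputable def uniformAngle : Measure ℝ :=
  ProbabilityTheory.cond volume (Set.Ico (-Real.pi) Real.pi)

/-- The number of samples per symbol, `L = ⌈β √SNR⌉`. -/
noncomputable def samplesPerSymbol (β snr : ℝ) : ℕ := ⌈β * Real.sqrt snr⌉₊

/-- The input symbols `X 0, X 1, …` are i.i.d.; for each of them the phase is uniform and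
independent of the amplitude, and `|X k|² - P/2` is exponential with mean `P/2`
(that is, with rate `2/P`). -/
structure IsInput {Ω : Type*} [MeasurableSpace Ω] (μ : Measure Ω) (P : ℝ) (X : ℕ → Ω → ℂ) :
    Prop where
  measurable : ∀ k, Measurable (X k)
  iIndep : iIndepFun X μ
  identDistrib : ∀ k, IdentDistrib (X k) (X 0) μ μ
  indep_abs_arg : ∀ k, IndepFun (fun ω => ‖X k ω‖) (fun ω => (X k ω).arg) μ
  law_arg : ∀ k, HasLaw (fun ω => (X k ω).arg) uniformAngle μ
  law_abs : ∀ k, HasLaw (fun ω => ‖X k ω‖ ^ 2 - P / 2) (expMeasure (2 / P)) μ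

/-- The additive noise `N` is i.i.d. circularly-symmetric complex Gaussian with `E|N k|² = σ² Δ`,
where `Δ = 1 / L` and `σ2` stands for `σ²`. -/
structure IsAdditiveNoise {Ω : Type*} [MeasurableSpace Ω] (μ : Measure Ω) (σ2 : ℝ) (L : ℕ)
    (N : ℕ → Ω → ℂ) : Prop where
  measurable : ∀ k, Measurable (N k)
  iIndep : iIndepFun N μ
  law : ∀ k, HasLaw (N k) (complexGaussian (σ2 * (1 / (L : ℝ)))) μ

/-- `Θ` is the discrete-time Wiener process with increments `W`: the initial phase is uniform on
`[-π, π)`, `Θ (k+1) = Θ k + W k`, the increments are i.i.d. real Gaussian of mean `0` and variance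
`2 π β Δ` with `Δ = 1 / L`, and they are independent of the initial phase. -/
structure IsWienerPhase {Ω : Type*} [MeasurableSpace Ω] (μ : Measure Ω) (β : ℝ) (L : ℕ)
    (Θ W : ℕ → Ω → ℝ) : Prop where
  measurable_init : Measurable (Θ 0)
  law_init : HasLaw (Θ 0) uniformAngle μ
  measurable_incr : ∀ k, Measurable (W k)
  iIndep : iIndepFun W μ
  law_incr : ∀ k, HasLaw (W k) (gaussianReal 0 (2 * Real.pi * β * (1 / (L : ℝ))).toNNReal) μ
  indep_init_incr : IndepFun (Θ 0) (fun ω k => W k ω) μ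
  step : ∀ k ω, Θ (k + 1) ω = Θ k ω + W k ω

/-- The random elements of the channel with `L` samples per symbol. The two independence
fields say that the input, the additive noise and the phase noise are mutually independent.
Symbols and samples are numbered from `0`. -/
structure IsModel {Ω : Type*} [MeasurableSpace Ω] (μ : Measure Ω) (β P σ2 : ℝ) (L : ℕ)
    (X N : ℕ → Ω → ℂ) (Θ W : ℕ → Ω → ℝ) : Prop where
  input : IsInput μ P X
  noise : IsAdditiveNoise μ σ2 L N
  phase : IsWienerPhase μ β L Θ W
  indep_input : IndepFun (fun ω k => X k ω) (fun ω => (fun k => N k ω, fun k => Θ k ω)) μ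
  indep_noise_phase : IndepFun (fun ω k => N k ω) (fun ω k => Θ k ω) μ

/-- The `k`-th output sample `Y k = X Δ e^{jΘ k} + N k`, `Δ = 1 / L`, where `X` is the symbol
being sent. With numbering from `0`, sample `k` belongs to symbol number `k / L`. -/
noncomputable def output {Ω : Type*} (L : ℕ) (X N : ℕ → Ω → ℂ) (Θ : ℕ → Ω → ℝ) (k : ℕ) (ω : Ω) :
    ℂ :=
  X (k / L) ω * (1 / (L : ℂ)) * Complex.exp (Complex.I * (Θ k ω : ℂ)) + N k ω

/-- The first `n` input symbols. -/
def inputBlock {Ω : Type*} (X : ℕ → Ω → ℂ) (n : ℕ) (ω : Ω) : Fin n → ℂ :=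
  fun m => X m ω

/-- The output vectors of the first `n` symbols, each consisting of the `L` samples belonging to
that symbol. -/
noncomputable def outputBlock {Ω : Type*} (L : ℕ) (X N : ℕ → Ω → ℂ) (Θ : ℕ → Ω → ℝ) (n : ℕ)
    (ω : Ω) : Fin n → Fin L → ℂ :=
  fun m l => output L X N Θ ((m : ℕ) * L + l) ω

/-- `r` is the information rate `I(X;Y) = lim (1/n) I(Xⁿ;Yⁿ)`: this limit exists and is the real
number `r`. -/
def IsInformationRate {Ω : Type*} [MeasurableSpace Ω] (μ : Measure Ω) (L : ℕ) (X N : ℕ → Ω → ℂ)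
    (Θ : ℕ → Ω → ℝ) (r : ℝ≥0) : Prop :=
  Tendsto (fun n : ℕ => mutualInfo μ (inputBlock X n) (outputBlock L X N Θ n) / (n : ℝ≥0∞))
    atTop (𝓝 (r : ℝ≥0∞))

end WienerPhaseNoise

/-!
The information rate exists by Fekete's lemma. Block mutual information is superadditive
(`IsModel.mutualInfo_add_le`): mutual information is superadditive over independent inputs
(`add_mutualInfo_le`), and input and output blocks are jointly stationary
(`IsModel.map_block_shift`), because the uniform initial phase makes the phase process modulo `2π`
stationary. It grows at most linearly (`IsModel.exists_mutualInfo_le`): adding Gaussian noise to a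
signal of finite energy bounds the conditional density of the output given the signal by a
constant, and the density of the output from below by a Gaussian function
(`mutualInfo_add_noise_le`).

The lower bound is the one achieved by a mismatched decoder. By the Donsker-Varadhan inequality
(`ofReal_integral_le_klDiv`), every nonnegative metric `d` on symbols and outputs gives a lower
bound `-E d - log E' exp (-d)` on the mutual information, where `E` is the mean over the channel
and `E'` the mean under independence of input and output. The metric used here is a sum over the
symbols of the block. For each symbol it adds two squared errors, scaled by their typical size:

* the error in `|x|²` of the unbiased estimate from the received energy `∑ |y l|²` of the symbol.
  Its variance is of the order `P σ²`, and `|x|²` has density at most `2 / P`, so an independent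
  symbol matches with probability of the order `√(P σ²) / P = SNR ^ (-1/2)`;
* the error in the first sample of the symbol of the prediction that takes its phase from the last
  sample of the preceding symbol. The phase increment between two samples and the additive noise
  give errors of the same order when `L` is of the order `√SNR`. As the amplitude of the symbol is
  at least `√(P / 2)` and its phase is uniform, an independent symbol matches with probability of
  the order `√(σ² L / P)`, that is, `SNR ^ (-1/4)`.

The phase reference involves the preceding symbol and the received samples only. Under
independence the symbols can therefore be integrated out one at a time, the last one first, and
the windows multiply (`IsInput.lintegral_exp_neg_metric_le`, `lintegral_prod_consecutive_le`).
Over the channel the metric has bounded mean (`IsModel.lintegral_blockMetric_le`,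
`metricBound_le`). Each symbol thus contributes at least `3/4 log SNR - O(1)`
(`IsModel.le_mutualInfo`, `log_mismatchBound_le`).
-/

namespace WienerPhaseNoise
open InformationTheory

/-! ### Variational bounds for the Kullback-Leibler divergence -/

section KullbackLeibler

variable {α : Type*} [MeasurableSpace α] {P Q : Measure α}

/-- The Donsker-Varadhan lower bound, in the form in which the exponential of the test function is
dominated by a sub-density `R` with respect to `Q`. -/
lemma ofReal_integral_le_klDiv [IsProbabilityMeasure P] [IsProbabilityMeasure Q]
    {R : α → ℝ≥0∞} (hR : Measurable R) (hRQ : ∫⁻ x, R x ∂Q ≤ 1) {f : α → ℝ}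
    (hf : Integrable f P) (hfR : ∀ᵐ x ∂P, ENNReal.ofReal (Real.exp (f x)) ≤ R x) :
    ENNReal.ofReal (∫ x, f x ∂P) ≤ klDiv P Q := by
  by_cases htop : klDiv P Q = ∞
  · simp [htop]
  obtain ⟨hac, hint⟩ := klDiv_ne_top_iff.1 htop
  rw [klDiv_of_ac_of_integrable hac hint]
  refine ENNReal.ofReal_le_ofReal ?_
  simp only [probReal_univ, add_sub_cancel_right]
  -- `f - llr ≤ exp (f - llr) - 1`, and `exp (f - llr)` is dominated by `R / (dP/dQ)`.
  have hbound : ∫⁻ x, ENNReal.ofReal (Real.exp (f x - llr P Q x)) ∂P ≤ 1 := by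
    calc ∫⁻ x, ENNReal.ofReal (Real.exp (f x - llr P Q x)) ∂P
        ≤ ∫⁻ x, R x * (P.rnDeriv Q x)⁻¹ ∂P := by
          refine lintegral_mono_ae ?_
          filter_upwards [hfR, Measure.rnDeriv_pos hac,
            hac.ae_le (Measure.rnDeriv_lt_top P Q)] with x hx hpos hlt
          rw [Real.exp_sub, llr, Real.exp_log (ENNReal.toReal_pos hpos.ne' hlt.ne),
            ENNReal.ofReal_div_of_pos (ENNReal.toReal_pos hpos.ne' hlt.ne),
            ENNReal.ofReal_toReal hlt.ne, div_eq_mul_inv]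
          gcongr
      _ = ∫⁻ x, P.rnDeriv Q x * (R x * (P.rnDeriv Q x)⁻¹) ∂Q := by
          rw [lintegral_rnDeriv_mul hac]
          fun_prop
      _ ≤ ∫⁻ x, R x ∂Q := by
          refine lintegral_mono fun x => ?_
          rw [mul_left_comm]
          exact mul_le_of_le_one_right' (ENNReal.mul_inv_le_one _)
      _ ≤ 1 := hRQ
  have hmeas : AEStronglyMeasurable (fun x => Real.exp (f x - llr P Q x)) P :=
    Real.continuous_exp.comp_aestronglyMeasurable (hf.sub hint).aestronglyMeasurable
  have hexp : Integrable (fun x => Real.exp (f x - llr P Q x)) P :=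
    (lintegral_ofReal_ne_top_iff_integrable hmeas (ae_of_all _ fun _ => (Real.exp_pos _).le)).1
      (hbound.trans_lt ENNReal.one_lt_top).ne
  have hle : ∫ x, Real.exp (f x - llr P Q x) ∂P ≤ 1 := by
    rw [integral_eq_lintegral_of_nonneg_ae (ae_of_all _ fun _ => (Real.exp_pos _).le) hmeas]
    exact ENNReal.toReal_le_of_le_ofReal zero_le_one (by simpa using hbound)
  have hdiff : ∫ x, (f x - llr P Q x) ∂P ≤ ∫ x, (Real.exp (f x - llr P Q x) - 1) ∂P :=
    integral_mono (hf.sub hint) (hexp.sub (integrable_const _)) fun x => by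
      have := Real.add_one_le_exp (f x - llr P Q x)
      simp only
      linarith
  rw [integral_sub hf hint, integral_sub hexp (integrable_const _)] at hdiff
  simp only [integral_const, probReal_univ, smul_eq_mul, mul_one] at hdiff
  linarith

/-- If `P` has density at most `exp g` with respect to `Q`, then `klDiv P Q` is at most the
`P`-mean of `g`, up to `1`. The extra `1` makes it unnecessary to treat the negative part of the
log-likelihood ratio. -/
lemma klDiv_le_lintegral_add_one [IsProbabilityMeasure P] [IsProbabilityMeasure Q] {g : α → ℝ}
    (hg : Measurable g) (hg0 : ∀ x, 0 ≤ g x)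
    (hPQ : P ≤ Q.withDensity fun x => ENNReal.ofReal (Real.exp (g x))) :
    klDiv P Q ≤ ∫⁻ x, ENNReal.ofReal (g x) ∂P + 1 := by
  have hac : P ≪ Q := (Measure.absolutelyContinuous_of_le hPQ).trans
    (withDensity_absolutelyContinuous _ _)
  have hr : P.rnDeriv Q ≤ᵐ[Q] fun x => ENNReal.ofReal (Real.exp (g x)) := by
    refine ae_le_of_forall_setLIntegral_le_of_sigmaFinite (Measure.measurable_rnDeriv P Q) ?_
    intro s hs _
    rw [Measure.setLIntegral_rnDeriv hac, ← withDensity_apply _ hs]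
    exact hPQ s
  rw [klDiv_eq_lintegral_klFun_of_ac hac]
  calc ∫⁻ x, ENNReal.ofReal (klFun (P.rnDeriv Q x).toReal) ∂Q
      ≤ ∫⁻ x, (P.rnDeriv Q x * ENNReal.ofReal (g x) + 1) ∂Q := by
        refine lintegral_mono_ae ?_
        filter_upwards [hr, Measure.rnDeriv_lt_top P Q] with x hx hlt
        set r := (P.rnDeriv Q x).toReal with hrdef
        have hr0 : 0 ≤ r := ENNReal.toReal_nonneg
        have hle : r ≤ Real.exp (g x) :=
          ENNReal.toReal_le_of_le_ofReal (Real.exp_pos _).le hx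
        have hkl : klFun r ≤ r * g x + 1 := by
          rw [klFun_apply]
          rcases hr0.eq_or_lt with h | h
          · simp [← h]
          · have : Real.log r ≤ g x := (Real.log_le_iff_le_exp h).2 hle
            nlinarith
        calc ENNReal.ofReal (klFun r) ≤ ENNReal.ofReal (r * g x + 1) :=
              ENNReal.ofReal_le_ofReal hkl
          _ = P.rnDeriv Q x * ENNReal.ofReal (g x) + 1 := by
              rw [ENNReal.ofReal_add (mul_nonneg hr0 (hg0 x)) zero_le_one,
                ENNReal.ofReal_mul hr0, hrdef, ENNReal.ofReal_toReal hlt.ne, ENNReal.ofReal_one]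
    _ = ∫⁻ x, ENNReal.ofReal (g x) ∂P + 1 := by
        rw [lintegral_add_right _ measurable_const, lintegral_rnDeriv_mul hac (by fun_prop)]
        simp

end KullbackLeibler

/-! ### Mutual information -/

section MutualInformation

variable {Ω Ω' S T S' T' : Type*} [MeasurableSpace Ω] [MeasurableSpace Ω'] [MeasurableSpace S]
  [MeasurableSpace T] [MeasurableSpace S'] [MeasurableSpace T'] {μ : Measure Ω} {ν : Measure Ω'}

/-- The data processing inequality for mutual information. -/
lemma mutualInfo_comp_le [IsProbabilityMeasure μ] {A : Ω → S} {B : Ω → T} (hA : Measurable A)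
    (hB : Measurable B) {f : S → S'} {g : T → T'} (hf : Measurable f) (hg : Measurable g) :
    mutualInfo μ (fun ω => f (A ω)) (fun ω => g (B ω)) ≤ mutualInfo μ A B := by
  have h := klDiv_map_le (μ := μ.map fun ω => (A ω, B ω)) (ν := (μ.map A).prod (μ.map B))
    (g := Prod.map f g) (hf.prodMap hg)
  rw [Measure.map_map (hf.prodMap hg) (hA.prodMk hB),
    ← Measure.map_prod_map _ _ hf hg, Measure.map_map hf hA, Measure.map_map hg hB] at h
  exact h

/-- Mutual information depends on the joint law only. -/
lemma mutualInfo_congr_law {A : Ω → S} {B : Ω → T} {A' : Ω' → S} {B' : Ω' → T}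
    (hA : Measurable A) (hB : Measurable B) (hA' : Measurable A') (hB' : Measurable B')
    (h : μ.map (fun ω => (A ω, B ω)) = ν.map (fun ω => (A' ω, B' ω))) :
    mutualInfo μ A B = mutualInfo ν A' B' := by
  have h1 := congrArg (Measure.map Prod.fst) h
  have h2 := congrArg (Measure.map Prod.snd) h
  rw [Measure.map_map measurable_fst (hA.prodMk hB),
    Measure.map_map measurable_fst (hA'.prodMk hB')] at h1
  rw [Measure.map_map measurable_snd (hA.prodMk hB),
    Measure.map_map measurable_snd (hA'.prodMk hB')] at h2
  simp only [mutualInfo]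
  change μ.map A = ν.map A' at h1
  change μ.map B = ν.map B' at h2
  rw [h, h1, h2]

/-- The likelihood ratio of the joint law to the product of its marginals integrates to at most one
over the first coordinate, for almost every value of the second. -/
lemma ae_lintegral_rnDeriv_prod_le_one [IsProbabilityMeasure μ] {A : Ω → S} {B : Ω → T}
    (hA : Measurable A) (hB : Measurable B) :
    ∀ᵐ b ∂μ.map B, ∫⁻ a, (μ.map fun ω => (A ω, B ω)).rnDeriv ((μ.map A).prod (μ.map B)) (a, b)
      ∂μ.map A ≤ 1 := by
  set r := (μ.map fun ω => (A ω, B ω)).rnDeriv ((μ.map A).prod (μ.map B)) with hr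
  have hrm : Measurable r := Measure.measurable_rnDeriv _ _
  refine ae_le_of_forall_setLIntegral_le_of_sigmaFinite (hrm.lintegral_prod_left') ?_
  intro s hs _
  calc ∫⁻ b in s, ∫⁻ a, r (a, b) ∂μ.map A ∂μ.map B
      = ∫⁻ z in Set.univ ×ˢ s, r z ∂((μ.map A).prod (μ.map B)) := by
        rw [← Measure.prod_restrict, Measure.restrict_univ, lintegral_prod_symm' _ hrm]
    _ ≤ (μ.map fun ω => (A ω, B ω)) (Set.univ ×ˢ s) := Measure.setLIntegral_rnDeriv_le _
    _ = ∫⁻ b in s, 1 ∂μ.map B := by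
        rw [Measure.map_apply (hA.prodMk hB) (MeasurableSet.univ.prod hs), setLIntegral_one,
          Measure.map_apply hB hs]
        congr 1
        ext ω
        simp

/-- Mutual information is superadditive over independent inputs. The product of the two
likelihood ratios is a sub-density with respect to the product of the marginals of the pairs,
because each likelihood ratio integrates to one over its own input. -/
lemma add_mutualInfo_le [IsProbabilityMeasure μ] {A : Ω → S} {B : Ω → T} {A' : Ω → S'} {B' : Ω → T'}
    (hA : Measurable A) (hB : Measurable B) (hA' : Measurable A') (hB' : Measurable B')
    (hind : IndepFun A A' μ) (hfin : mutualInfo μ A B ≠ ∞) (hfin' : mutualInfo μ A' B' ≠ ∞) :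
    mutualInfo μ A B + mutualInfo μ A' B' ≤
      mutualInfo μ (fun ω => (A ω, A' ω)) (fun ω => (B ω, B' ω)) := by
  have := Measure.isProbabilityMeasure_map (μ := μ) hA.aemeasurable
  have := Measure.isProbabilityMeasure_map (μ := μ) hB.aemeasurable
  have := Measure.isProbabilityMeasure_map (μ := μ) (hA.prodMk hB).aemeasurable
  have := Measure.isProbabilityMeasure_map (μ := μ) hA'.aemeasurable
  have := Measure.isProbabilityMeasure_map (μ := μ) hB'.aemeasurable
  have := Measure.isProbabilityMeasure_map (μ := μ) (hA'.prodMk hB').aemeasurable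
  have := Measure.isProbabilityMeasure_map (μ := μ) (hB.prodMk hB').aemeasurable
  have := Measure.isProbabilityMeasure_map (μ := μ) (hA.prodMk hA').aemeasurable
  have hall : Measurable fun ω => ((A ω, A' ω), (B ω, B' ω)) := by fun_prop
  have := Measure.isProbabilityMeasure_map (μ := μ) hall.aemeasurable
  set P₁ := μ.map fun ω => (A ω, B ω)
  set Q₁ := (μ.map A).prod (μ.map B)
  set P₂ := μ.map fun ω => (A' ω, B' ω)
  set Q₂ := (μ.map A').prod (μ.map B')
  obtain ⟨hac, hint⟩ : P₁ ≪ Q₁ ∧ Integrable (llr P₁ Q₁) P₁ := klDiv_ne_top_iff.1 hfin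
  obtain ⟨hac', hint'⟩ : P₂ ≪ Q₂ ∧ Integrable (llr P₂ Q₂) P₂ := klDiv_ne_top_iff.1 hfin'
  have hm₁ : Measurable fun z : (S × S') × (T × T') => (z.1.1, z.2.1) := by fun_prop
  have hm₂ : Measurable fun z : (S × S') × (T × T') => (z.1.2, z.2.2) := by fun_prop
  have hmap₁ : (μ.map fun ω => ((A ω, A' ω), (B ω, B' ω))).map (fun z => (z.1.1, z.2.1)) = P₁ :=
    Measure.map_map hm₁ hall
  have hmap₂ : (μ.map fun ω => ((A ω, A' ω), (B ω, B' ω))).map (fun z => (z.1.2, z.2.2)) = P₂ :=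
    Measure.map_map hm₂ hall
  have hi₁ : Integrable (fun z : (S × S') × (T × T') => llr P₁ Q₁ (z.1.1, z.2.1))
      (μ.map fun ω => ((A ω, A' ω), (B ω, B' ω))) :=
    Integrable.comp_measurable (g := llr P₁ Q₁) (by rw [hmap₁]; exact hint) hm₁
  have hi₂ : Integrable (fun z : (S × S') × (T × T') => llr P₂ Q₂ (z.1.2, z.2.2))
      (μ.map fun ω => ((A ω, A' ω), (B ω, B' ω))) :=
    Integrable.comp_measurable (g := llr P₂ Q₂) (by rw [hmap₂]; exact hint') hm₂
  have key := ofReal_integral_le_klDiv (P := μ.map fun ω => ((A ω, A' ω), (B ω, B' ω)))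
    (Q := (μ.map fun ω => (A ω, A' ω)).prod (μ.map fun ω => (B ω, B' ω)))
    (R := fun z => P₁.rnDeriv Q₁ (z.1.1, z.2.1) * P₂.rnDeriv Q₂ (z.1.2, z.2.2))
    (by fun_prop) ?_ (hi₁.add hi₂) ?_
  · refine le_trans (le_of_eq ?_) key
    simp only [Pi.add_apply]
    rw [integral_add hi₁ hi₂]
    have e₁ : ∫ z, llr P₁ Q₁ (z.1.1, z.2.1) ∂(μ.map fun ω => ((A ω, A' ω), (B ω, B' ω)))
        = ∫ z, llr P₁ Q₁ z ∂P₁ := by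
      exact (integral_map (f := llr P₁ Q₁) hm₁.aemeasurable
        (by rw [hmap₁]; exact hint.aestronglyMeasurable)).symm.trans (by rw [hmap₁])
    have e₂ : ∫ z, llr P₂ Q₂ (z.1.2, z.2.2) ∂(μ.map fun ω => ((A ω, A' ω), (B ω, B' ω)))
        = ∫ z, llr P₂ Q₂ z ∂P₂ := by
      exact (integral_map (f := llr P₂ Q₂) hm₂.aemeasurable
        (by rw [hmap₂]; exact hint'.aestronglyMeasurable)).symm.trans (by rw [hmap₂])
    have n₁ := integral_llr_add_sub_measure_univ_nonneg hac hint
    have n₂ := integral_llr_add_sub_measure_univ_nonneg hac' hint'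
    simp only [probReal_univ, add_sub_cancel_right] at n₁ n₂
    rw [e₁, e₂, ENNReal.ofReal_add n₁ n₂]
    change klDiv P₁ Q₁ + klDiv P₂ Q₂ = _
    rw [klDiv_of_ac_of_integrable hac hint, klDiv_of_ac_of_integrable hac' hint']
    simp
  · rw [(indepFun_iff_map_prod_eq_prod_map_map hA.aemeasurable hA'.aemeasurable).1 hind,
      lintegral_prod_symm' _ (by fun_prop)]
    have b₁ : ∀ᵐ b ∂μ.map (fun ω => (B ω, B' ω)), ∫⁻ a, P₁.rnDeriv Q₁ (a, b.1) ∂μ.map A ≤ 1 := by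
      refine ae_of_ae_map (f := Prod.fst) measurable_fst.aemeasurable
        (p := fun b => ∫⁻ a, P₁.rnDeriv Q₁ (a, b) ∂μ.map A ≤ 1) ?_
      rw [Measure.map_map measurable_fst (hB.prodMk hB')]
      exact ae_lintegral_rnDeriv_prod_le_one hA hB
    have b₂ : ∀ᵐ b ∂μ.map (fun ω => (B ω, B' ω)), ∫⁻ a, P₂.rnDeriv Q₂ (a, b.2) ∂μ.map A' ≤ 1 := by
      refine ae_of_ae_map (f := Prod.snd) measurable_snd.aemeasurable
        (p := fun b => ∫⁻ a, P₂.rnDeriv Q₂ (a, b) ∂μ.map A' ≤ 1) ?_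
      rw [Measure.map_map measurable_snd (hB.prodMk hB')]
      exact ae_lintegral_rnDeriv_prod_le_one hA' hB'
    calc _ ≤ ∫⁻ _, 1 ∂μ.map (fun ω => (B ω, B' ω)) := by
          refine lintegral_mono_ae ?_
          filter_upwards [b₁, b₂] with b h₁ h₂
          rw [lintegral_prod_mul (f := fun a => P₁.rnDeriv Q₁ (a, b.1))
            (g := fun a => P₂.rnDeriv Q₂ (a, b.2))
            (Measurable.aemeasurable (by fun_prop)) (Measurable.aemeasurable (by fun_prop))]
          exact mul_le_one' h₁ h₂
      _ = 1 := by simp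
  · have a₁ : ∀ᵐ z ∂(μ.map fun ω => ((A ω, A' ω), (B ω, B' ω))),
        Real.exp (llr P₁ Q₁ (z.1.1, z.2.1)) = (P₁.rnDeriv Q₁ (z.1.1, z.2.1)).toReal ∧
          P₁.rnDeriv Q₁ (z.1.1, z.2.1) < ∞ := by
      refine ae_of_ae_map (f := fun z : (S × S') × (T × T') => (z.1.1, z.2.1)) hm₁.aemeasurable
        (p := fun z => Real.exp (llr P₁ Q₁ z) = (P₁.rnDeriv Q₁ z).toReal ∧
          P₁.rnDeriv Q₁ z < ∞) ?_
      rw [hmap₁]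
      filter_upwards [exp_llr_of_ac _ _ hac, hac.ae_le (Measure.rnDeriv_lt_top P₁ Q₁)] with z h h'
      exact ⟨h, h'⟩
    have a₂ : ∀ᵐ z ∂(μ.map fun ω => ((A ω, A' ω), (B ω, B' ω))),
        Real.exp (llr P₂ Q₂ (z.1.2, z.2.2)) = (P₂.rnDeriv Q₂ (z.1.2, z.2.2)).toReal ∧
          P₂.rnDeriv Q₂ (z.1.2, z.2.2) < ∞ := by
      refine ae_of_ae_map (f := fun z : (S × S') × (T × T') => (z.1.2, z.2.2)) hm₂.aemeasurable
        (p := fun z => Real.exp (llr P₂ Q₂ z) = (P₂.rnDeriv Q₂ z).toReal ∧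
          P₂.rnDeriv Q₂ z < ∞) ?_
      rw [hmap₂]
      filter_upwards [exp_llr_of_ac _ _ hac', hac'.ae_le (Measure.rnDeriv_lt_top P₂ Q₂)] with z h h'
      exact ⟨h, h'⟩
    filter_upwards [a₁, a₂] with z h₁ h₂
    rw [Pi.add_apply, Real.exp_add, h₁.1, h₂.1, ENNReal.ofReal_mul ENNReal.toReal_nonneg,
      ENNReal.ofReal_toReal h₁.2.ne, ENNReal.ofReal_toReal h₂.2.ne]

end MutualInformation

/-! ### Gaussian, exponential and uniform laws -/

section Laws

open Real

lemma lintegral_exp_neg_mul_sq {b : ℝ} (hb : 0 < b) (a : ℝ) :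
    ∫⁻ x : ℝ, ENNReal.ofReal (rexp (-b * (x - a) ^ 2)) = ENNReal.ofReal √(π / b) := by
  rw [lintegral_sub_right_eq_self (fun x => ENNReal.ofReal (rexp (-b * x ^ 2))) a,
    ← ofReal_integral_eq_lintegral_ofReal (integrable_exp_neg_mul_sq hb)
      (ae_of_all _ fun _ => (exp_pos _).le), integral_gaussian]

lemma expMeasure_le_smul_volume {r : ℝ} (hr : 0 < r) :
    expMeasure r ≤ ENNReal.ofReal r • volume := by
  have h : (expMeasure r : Measure ℝ) = volume.withDensity (exponentialPDF r) := rfl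
  rw [h, ← withDensity_const]
  refine withDensity_mono (ae_of_all _ fun x => ?_)
  rw [exponentialPDF_eq]
  refine ENNReal.ofReal_le_ofReal ?_
  split_ifs with hx
  · exact mul_le_of_le_one_right hr.le (exp_le_one_iff.2 (by nlinarith [mul_nonneg hr.le hx]))
  · exact hr.le

lemma expMeasure_ae_nonneg (r : ℝ) : ∀ᵐ x ∂expMeasure r, 0 ≤ x := by
  have h : (expMeasure r : Measure ℝ) = volume.withDensity (exponentialPDF r) := rfl
  have hm : Measurable (exponentialPDF r) := (measurable_exponentialPDFReal r).ennreal_ofReal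
  rw [h, ae_withDensity_iff hm]
  refine ae_of_all _ fun x hx => ?_
  by_contra hneg
  exact hx (exponentialPDF_of_neg (not_le.1 hneg))

/-- A crude bound on the mean of the exponential law, from `r x / 2 ≤ exp (r x / 2)`. -/
lemma lintegral_expMeasure_le {r : ℝ} (hr : 0 < r) :
    ∫⁻ x, ENNReal.ofReal x ∂expMeasure r ≤ ENNReal.ofReal (4 / r) := by
  have h : (expMeasure r : Measure ℝ) = volume.withDensity (exponentialPDF r) := rfl
  have hm : Measurable (exponentialPDF r) := (measurable_exponentialPDFReal r).ennreal_ofReal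
  rw [h, lintegral_withDensity_eq_lintegral_mul _ hm (by fun_prop)]
  calc ∫⁻ x, exponentialPDF r x * ENNReal.ofReal x
      ≤ ∫⁻ x, ENNReal.ofReal (4 / r) * exponentialPDF (r / 2) x := by
        refine lintegral_mono fun x => ?_
        rcases lt_or_ge x 0 with hx | hx
        · simp [exponentialPDF_of_neg hx]
        · rw [exponentialPDF_of_nonneg hx, exponentialPDF_of_nonneg hx,
            ← ENNReal.ofReal_mul (by positivity), ← ENNReal.ofReal_mul (by positivity)]
          refine ENNReal.ofReal_le_ofReal ?_
          have e : rexp (-(r * x)) = rexp (-(r / 2 * x)) * rexp (-(r / 2 * x)) := by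
            rw [← exp_add]; ring_nf
          have e' : rexp (r / 2 * x) * rexp (-(r / 2 * x)) = 1 := by
            rw [← exp_add]; simp
          have hle : r / 2 * x * rexp (-(r / 2 * x)) ≤ 1 := by
            rw [← e']
            gcongr
            linarith [add_one_le_exp (r / 2 * x)]
          have hr' : 4 / r * (r / 2 * rexp (-(r / 2 * x))) = 2 * rexp (-(r / 2 * x)) := by
            field_simp; norm_num
          rw [hr', e]
          nlinarith [exp_pos (-(r / 2 * x))]
    _ = ENNReal.ofReal (4 / r) := by
        have hm' : Measurable (exponentialPDF (r / 2)) :=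
          (measurable_exponentialPDFReal _).ennreal_ofReal
        rw [lintegral_const_mul _ hm', lintegral_exponentialPDF_eq_one (by positivity), mul_one]

/-- A Gaussian-shaped window of squared width `s` catches at most `r √(2 π s)` of the mass of the
exponential law of rate `r`. -/
lemma lintegral_expMeasure_exp_le {r s : ℝ} (hr : 0 < r) (hs : 0 < s) (a : ℝ) :
    ∫⁻ x, ENNReal.ofReal (rexp (-(a - x) ^ 2 / (2 * s))) ∂expMeasure r
      ≤ ENNReal.ofReal (r * √(2 * π * s)) := by
  calc ∫⁻ x, ENNReal.ofReal (rexp (-(a - x) ^ 2 / (2 * s))) ∂expMeasure r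
      ≤ ∫⁻ x, ENNReal.ofReal (rexp (-(a - x) ^ 2 / (2 * s))) ∂(ENNReal.ofReal r • volume) :=
        lintegral_mono' (expMeasure_le_smul_volume hr) le_rfl
    _ = ENNReal.ofReal r * ∫⁻ x, ENNReal.ofReal (rexp (-(1 / (2 * s)) * (x - a) ^ 2)) := by
        rw [lintegral_smul_measure, smul_eq_mul]
        congr 2
        ext x
        congr 2
        ring
    _ = ENNReal.ofReal (r * √(2 * π * s)) := by
        rw [lintegral_exp_neg_mul_sq (by positivity), ← ENNReal.ofReal_mul hr.le]
        congr 3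
        field_simp

lemma uniformAngle_eq : uniformAngle =
    ENNReal.ofReal (2 * π)⁻¹ • (volume : Measure ℝ).restrict (Set.Ioc (-π) π) := by
  have h : (volume : Measure ℝ).restrict (Set.Ico (-π) π) = volume.restrict (Set.Ioc (-π) π) :=
    restrict_Ico_eq_restrict_Ioc
  rw [uniformAngle, ProbabilityTheory.cond, h, Real.volume_Ico,
    ENNReal.ofReal_inv_of_pos (by positivity)]
  congr 3
  ring

instance : IsProbabilityMeasure uniformAngle := by
  refine cond_isProbabilityMeasure_of_finite ?_ ?_ <;> simp [Real.volume_Ico, pi_pos]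

/-- The law of a uniform point of the unit circle is invariant under rotations. -/
lemma lintegral_uniformAngle_add {F : ℝ → ℝ≥0∞} (hF : Function.Periodic F (2 * π)) (c : ℝ) :
    ∫⁻ φ, F (φ + c) ∂uniformAngle = ∫⁻ φ, F φ ∂uniformAngle := by
  have hT : 0 < 2 * π := by positivity
  simp only [uniformAngle_eq, lintegral_smul_measure]
  congr 1
  have h1 : ∫⁻ φ in Set.Ioc (-π) π, F (φ + c) = ∫⁻ φ in Set.Ioc (-π + c) (π + c), F φ := by
    have := (measurePreserving_add_right (volume : Measure ℝ) c).setLIntegral_comp_preimage_emb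
      (measurableEmbedding_addRight c) F (Set.Ioc (-π + c) (π + c))
    rw [← this]
    congr 2
    ext x
    simp
  have e1 : π + c = -π + c + 2 * π := by ring
  have e2 : Set.Ioc (-π) π = Set.Ioc (-π) (-π + 2 * π) := by congr 1; ring
  rw [h1, e1, e2]
  refine (isAddFundamentalDomain_Ioc hT (-π + c)).setLIntegral_eq
    (isAddFundamentalDomain_Ioc hT (-π)) F ?_
  rintro ⟨g, hg⟩ x
  obtain ⟨n, rfl⟩ := AddSubgroup.mem_zmultiples_iff.1 hg
  change F (n • (2 * π) + x) = F x
  rw [add_comm]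
  exact hF.zsmul n x

lemma periodic_comp_exp_I (h : ℂ → ℝ≥0∞) :
    Function.Periodic (fun φ : ℝ => h (Complex.exp (Complex.I * φ))) (2 * π) := by
  intro φ
  simp only
  congr 1
  rw [Complex.exp_eq_exp_iff_exists_int]
  exact ⟨1, by push_cast; ring⟩

/-- The distance from a point of the circle of radius `u` to any fixed point is at least the
distance to the diameter through that point. -/
lemma sq_mul_sin_sq_le (u ψ : ℝ) (w : ℂ) :
    u ^ 2 * sin (ψ - w.arg) ^ 2 ≤ ‖w - u * Complex.exp (Complex.I * ψ)‖ ^ 2 := by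
  have hre : w.re = ‖w‖ * cos w.arg := (Complex.norm_mul_cos_arg w).symm
  have him : w.im = ‖w‖ * sin w.arg := (Complex.norm_mul_sin_arg w).symm
  rw [← Complex.normSq_eq_norm_sq, Complex.normSq_apply, mul_comm Complex.I]
  simp only [Complex.sub_re, Complex.sub_im, Complex.re_ofReal_mul, Complex.im_ofReal_mul,
    Complex.exp_ofReal_mul_I_re, Complex.exp_ofReal_mul_I_im]
  rw [hre, him, sin_sub]
  set ρ := ‖w‖
  set C := cos w.arg
  set S := sin w.arg
  have h1 : C ^ 2 = 1 - S ^ 2 := by have := sin_sq_add_cos_sq w.arg; linarith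
  have key : (ρ * C - u * cos ψ) * (ρ * C - u * cos ψ) + (ρ * S - u * sin ψ) * (ρ * S - u * sin ψ)
      - u ^ 2 * (sin ψ * C - cos ψ * S) ^ 2 = (ρ - u * (cos ψ * C + sin ψ * S)) ^ 2 := by
    linear_combination (ρ ^ 2 - u ^ 2 * (cos ψ ^ 2 + sin ψ ^ 2)) * h1
  nlinarith [sq_nonneg (ρ - u * (cos ψ * C + sin ψ * S))]

/-- By Jordan's inequality, `sin²` is at least a multiple of the squared distance to the nearest of
its zeros `0`, `π`, `-π`. -/
lemma exp_neg_sin_sq_le {K φ : ℝ} (hK : 0 ≤ K) (hφ : φ ∈ Set.Ioc (-π) π) :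
    rexp (-K * sin φ ^ 2) ≤ rexp (-(4 * K / π ^ 2) * (φ - 0) ^ 2) +
      rexp (-(4 * K / π ^ 2) * (φ - π) ^ 2) + rexp (-(4 * K / π ^ 2) * (φ - -π) ^ 2) := by
  have key : ∀ x : ℝ, |x| ≤ π / 2 → sin x ^ 2 = sin φ ^ 2 →
      rexp (-K * sin φ ^ 2) ≤ rexp (-(4 * K / π ^ 2) * x ^ 2) := by
    intro x hx hs
    refine exp_le_exp.2 ?_
    have h := mul_abs_le_abs_sin hx
    have h2 : (2 / π * |x|) ^ 2 ≤ |sin x| ^ 2 := by gcongr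
    rw [mul_pow, sq_abs, sq_abs, hs] at h2
    have : 4 * K / π ^ 2 * x ^ 2 = K * ((2 / π) ^ 2 * x ^ 2) := by ring
    rw [neg_mul, neg_mul, neg_le_neg_iff, this]
    gcongr
  have p0 := exp_pos (-(4 * K / π ^ 2) * (φ - 0) ^ 2)
  have p1 := exp_pos (-(4 * K / π ^ 2) * (φ - π) ^ 2)
  have p2 := exp_pos (-(4 * K / π ^ 2) * (φ - -π) ^ 2)
  rcases le_or_gt |φ| (π / 2) with h | h
  · have := key (φ - 0) (by simpa using h) (by simp)
    linarith
  · rcases lt_abs.1 h with h | h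
    · have := key (φ - π) (by rw [abs_le]; constructor <;> linarith [hφ.2]) (by simp [sin_sub_pi])
      linarith
    · have := key (φ - -π) (by rw [abs_le]; constructor <;> linarith [hφ.1]) (by simp [sin_add_pi])
      linarith

/-- A Gaussian-shaped window of squared width `v` catches at most `2 √v / u` of the mass of the
uniform law on the circle of radius `u`. -/
lemma lintegral_uniformAngle_exp_le {u v : ℝ} (hu : 0 < u) (hv : 0 < v) (w : ℂ) :
    ∫⁻ φ, ENNReal.ofReal (rexp (-‖w - u * Complex.exp (Complex.I * (φ : ℝ))‖ ^ 2 / (2 * v)))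
      ∂uniformAngle ≤ ENNReal.ofReal (2 * √v / u) := by
  set K : ℝ := u ^ 2 / (2 * v) with hK
  have hK0 : 0 < K := by positivity
  have hper : Function.Periodic (fun φ : ℝ => ENNReal.ofReal (rexp (-K * sin φ ^ 2))) (2 * π) := by
    intro φ; simp
  have hb : 0 < 4 * K / π ^ 2 := by positivity
  calc ∫⁻ φ, ENNReal.ofReal (rexp (-‖w - u * Complex.exp (Complex.I * (φ : ℝ))‖ ^ 2 / (2 * v)))
        ∂uniformAngle
      ≤ ∫⁻ φ, ENNReal.ofReal (rexp (-K * sin (φ + -w.arg) ^ 2)) ∂uniformAngle := by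
        refine lintegral_mono fun φ => ENNReal.ofReal_le_ofReal (exp_le_exp.2 ?_)
        have h := sq_mul_sin_sq_le u φ w
        rw [neg_mul, neg_div, neg_le_neg_iff, hK, div_mul_eq_mul_div, ← sub_eq_add_neg]
        gcongr
    _ = ∫⁻ φ, ENNReal.ofReal (rexp (-K * sin φ ^ 2)) ∂uniformAngle :=
        lintegral_uniformAngle_add hper (-w.arg)
    _ = ENNReal.ofReal (2 * π)⁻¹ *
          ∫⁻ φ in Set.Ioc (-π) π, ENNReal.ofReal (rexp (-K * sin φ ^ 2)) := by
        rw [uniformAngle_eq, lintegral_smul_measure, smul_eq_mul]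
    _ ≤ ENNReal.ofReal (2 * π)⁻¹ *
          ∫⁻ φ in Set.Ioc (-π) π, (ENNReal.ofReal (rexp (-(4 * K / π ^ 2) * (φ - 0) ^ 2)) +
            ENNReal.ofReal (rexp (-(4 * K / π ^ 2) * (φ - π) ^ 2)) +
            ENNReal.ofReal (rexp (-(4 * K / π ^ 2) * (φ - -π) ^ 2))) := by
        refine mul_le_mul_right (setLIntegral_mono (by fun_prop) fun φ hφ => ?_) _
        rw [← ENNReal.ofReal_add (by positivity) (by positivity),
          ← ENNReal.ofReal_add (by positivity) (by positivity)]
        exact ENNReal.ofReal_le_ofReal (exp_neg_sin_sq_le hK0.le hφ)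
    _ ≤ ENNReal.ofReal (2 * π)⁻¹ *
          ∫⁻ φ : ℝ, (ENNReal.ofReal (rexp (-(4 * K / π ^ 2) * (φ - 0) ^ 2)) +
            ENNReal.ofReal (rexp (-(4 * K / π ^ 2) * (φ - π) ^ 2)) +
            ENNReal.ofReal (rexp (-(4 * K / π ^ 2) * (φ - -π) ^ 2))) := by
        gcongr
        exact Measure.restrict_le_self
    _ = ENNReal.ofReal ((2 * π)⁻¹ * (3 * √(π / (4 * K / π ^ 2)))) := by
        rw [lintegral_add_right _ (by fun_prop), lintegral_add_right _ (by fun_prop),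
          lintegral_exp_neg_mul_sq hb, lintegral_exp_neg_mul_sq hb, lintegral_exp_neg_mul_sq hb,
          ← ENNReal.ofReal_add (by positivity) (by positivity),
          ← ENNReal.ofReal_add (by positivity) (by positivity),
          ← ENNReal.ofReal_mul (by positivity)]
        congr 2
        ring
    _ ≤ ENNReal.ofReal (2 * √v / u) := by
        refine ENNReal.ofReal_le_ofReal ?_
        have hle : √(π / (4 * K / π ^ 2)) ≤ 4 / 3 * π * (√v / u) := by
          refine sqrt_le_iff.2 ⟨by positivity, ?_⟩
          rw [mul_pow, mul_pow, div_pow √v, sq_sqrt hv.le, hK]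
          have e : π / (4 * (u ^ 2 / (2 * v)) / π ^ 2) = π ^ 2 * (v / u ^ 2) * (π / 2) := by
            field_simp; norm_num
          rw [e]
          have : π / 2 ≤ (4 / 3) ^ 2 := by nlinarith [pi_lt_d2]
          have h0 : 0 ≤ π ^ 2 * (v / u ^ 2) := by positivity
          nlinarith
        calc (2 * π)⁻¹ * (3 * √(π / (4 * K / π ^ 2)))
            ≤ (2 * π)⁻¹ * (3 * (4 / 3 * π * (√v / u))) := by gcongr
          _ = 2 * √v / u := by field_simp; norm_num

end Laws

/-! ### The complex Gaussian law -/

section ComplexGaussian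

open Real

/-- The density of the circularly-symmetric complex Gaussian law with `E|Z|² = v`. -/
noncomputable def complexGaussianPDF (v : ℝ) (z : ℂ) : ℝ≥0∞ :=
  ENNReal.ofReal ((π * v)⁻¹ * rexp (-‖z‖ ^ 2 / v))

lemma measurable_complexGaussianPDF (v : ℝ) : Measurable (complexGaussianPDF v) := by
  unfold complexGaussianPDF
  fun_prop

instance (v : ℝ) : IsProbabilityMeasure (complexGaussian v) := by
  unfold complexGaussian
  refine Measure.isProbabilityMeasure_map (Measurable.aemeasurable ?_)
  exact Complex.measurableEquivRealProd.symm.measurable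

lemma complexGaussian_eq_withDensity {v : ℝ} (hv : 0 < v) :
    complexGaussian v = volume.withDensity (complexGaussianPDF v) := by
  have hv2 : (v / 2).toNNReal ≠ 0 := by simpa using hv
  have hmap : complexGaussian v = ((gaussianReal 0 (v / 2).toNNReal).prod
      (gaussianReal 0 (v / 2).toNNReal)).map Complex.measurableEquivRealProd.symm := rfl
  rw [hmap, gaussianReal_of_var_ne_zero _ hv2,
    prod_withDensity (measurable_gaussianPDF _ _) (measurable_gaussianPDF _ _)]
  ext s hs
  rw [Measure.map_apply Complex.measurableEquivRealProd.symm.measurable hs,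
    withDensity_apply _ (Complex.measurableEquivRealProd.symm.measurable hs),
    withDensity_apply _ hs,
    ← Complex.volume_preserving_equiv_real_prod.symm.setLIntegral_comp_preimage hs
      (measurable_complexGaussianPDF v), Measure.volume_eq_prod]
  refine lintegral_congr fun p => ?_
  have hco : ((v / 2).toNNReal : ℝ) = v / 2 := Real.coe_toNNReal _ (by positivity)
  rw [complexGaussianPDF, gaussianPDF, gaussianPDF,
    ← ENNReal.ofReal_mul (gaussianPDFReal_nonneg _ _ _)]
  congr 1
  rw [gaussianPDFReal, gaussianPDFReal, hco, ← Complex.normSq_eq_norm_sq, Complex.normSq_apply,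
    Complex.measurableEquivRealProd_symm_apply, mul_mul_mul_comm, ← exp_add, ← mul_inv,
    mul_self_sqrt (by positivity)]
  congr 2
  · ring
  · field_simp
    ring

lemma hasLaw_re_complexGaussian (v : ℝ) :
    HasLaw Complex.re (gaussianReal 0 (v / 2).toNNReal) (complexGaussian v) where
  aemeasurable := by fun_prop
  map_eq := by
    exact (Measure.map_map Complex.measurable_re
      Complex.measurableEquivRealProd.symm.measurable).trans (Measure.map_fst_prod.trans (by simp))

lemma hasLaw_im_complexGaussian (v : ℝ) :
    HasLaw Complex.im (gaussianReal 0 (v / 2).toNNReal) (complexGaussian v) where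
  aemeasurable := by fun_prop
  map_eq := by
    exact (Measure.map_map Complex.measurable_im
      Complex.measurableEquivRealProd.symm.measurable).trans (Measure.map_snd_prod.trans (by simp))

lemma integral_sq_gaussianReal (w : ℝ≥0) : ∫ x, x ^ 2 ∂gaussianReal 0 w = w := by
  have h := variance_fun_id_gaussianReal (μ := 0) (v := w)
  rwa [variance_of_integral_eq_zero aemeasurable_id' (by simp)] at h

lemma integrable_pow_gaussianReal (w : ℝ≥0) (n : ℕ) :
    Integrable (fun x => x ^ n) (gaussianReal 0 w) := by
  have h := (memLp_id_gaussianReal (μ := 0) (v := w) (n : ℝ≥0)).integrable_norm_pow'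
  refine (integrable_norm_iff (by fun_prop)).1 ?_
  simpa using h

/-- A crude bound on the fourth moment of the Gaussian law, from `y⁴ / 4! ≤ exp y + exp (-y)` at
the scale of the standard deviation. -/
lemma integral_pow_four_gaussianReal_le {w : ℝ≥0} (hw : 0 < w) :
    ∫ x, x ^ 4 ∂gaussianReal 0 w ≤ 96 * (w : ℝ) ^ 2 := by
  have hw' : (0 : ℝ) < w := hw
  set t : ℝ := (√(w : ℝ))⁻¹ with ht
  have ht2 : t ^ 2 = (w : ℝ)⁻¹ := by rw [ht, inv_pow, sq_sqrt hw'.le]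
  have hpt : ∀ x : ℝ, x ^ 4 ≤ 24 * (w : ℝ) ^ 2 * (rexp (t * x) + rexp (-t * x)) := by
    intro x
    have h := pow_div_factorial_le_exp |t * x| (abs_nonneg _) 4
    have h2 : rexp |t * x| ≤ rexp (t * x) + rexp (-t * x) := by
      rcases abs_cases (t * x) with ⟨e, _⟩ | ⟨e, _⟩ <;> rw [e]
      · linarith [exp_pos (-t * x)]
      · rw [← neg_mul]; linarith [exp_pos (t * x)]
    have h3 : |t * x| ^ 4 = ((w : ℝ) ^ 2)⁻¹ * x ^ 4 := by
      rw [Even.pow_abs (by decide), mul_pow, show t ^ 4 = (t ^ 2) ^ 2 by ring, ht2, inv_pow]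
    have h4 : ((Nat.factorial 4 : ℕ) : ℝ) = 24 := by norm_num [Nat.factorial]
    rw [h3, h4, div_le_iff₀ (by norm_num), inv_mul_le_iff₀ (by positivity)] at h
    nlinarith [sq_nonneg (w : ℝ), sq_pos_of_pos hw']
  have i1 := integrable_exp_mul_gaussianReal (μ := 0) (v := w) t
  have i2 := integrable_exp_mul_gaussianReal (μ := 0) (v := w) (-t)
  have m : ∀ s : ℝ, ∫ x, rexp (s * x) ∂gaussianReal 0 w = rexp (w * s ^ 2 / 2) := by
    intro s
    have := congrFun (mgf_id_gaussianReal (μ := 0) (v := w)) s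
    simpa [mgf] using this
  calc ∫ x, x ^ 4 ∂gaussianReal 0 w
      ≤ ∫ x, 24 * (w : ℝ) ^ 2 * (rexp (t * x) + rexp (-t * x)) ∂gaussianReal 0 w :=
        integral_mono (integrable_pow_gaussianReal w 4) ((i1.add i2).const_mul _) hpt
    _ = 24 * (w : ℝ) ^ 2 * (2 * rexp (1 / 2)) := by
        rw [integral_const_mul, integral_add i1 i2, m, m, neg_sq, ht2, mul_inv_cancel₀ hw'.ne']
        ring
    _ ≤ 96 * (w : ℝ) ^ 2 := by
        have : rexp (1 / 2) ≤ 2 := by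
          have h := exp_one_lt_d9
          have : rexp (1 / 2) ^ 2 = rexp 1 := by rw [← exp_nat_mul]; norm_num
          nlinarith [exp_pos (1 / 2)]
        nlinarith [sq_nonneg (w : ℝ)]

variable {v : ℝ}

lemma integral_re_complexGaussian : ∫ z, z.re ∂complexGaussian v = 0 := by
  rw [(hasLaw_re_complexGaussian v).integral_eq, integral_id_gaussianReal]

lemma integral_im_complexGaussian : ∫ z, z.im ∂complexGaussian v = 0 := by
  rw [(hasLaw_im_complexGaussian v).integral_eq, integral_id_gaussianReal]

lemma integrable_re_pow_complexGaussian (n : ℕ) :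
    Integrable (fun z => z.re ^ n) (complexGaussian v) := by
  have h := integrable_pow_gaussianReal (v / 2).toNNReal n
  rw [← (hasLaw_re_complexGaussian v).map_eq] at h
  exact h.comp_measurable Complex.measurable_re

lemma integrable_im_pow_complexGaussian (n : ℕ) :
    Integrable (fun z => z.im ^ n) (complexGaussian v) := by
  have h := integrable_pow_gaussianReal (v / 2).toNNReal n
  rw [← (hasLaw_im_complexGaussian v).map_eq] at h
  exact h.comp_measurable Complex.measurable_im

lemma integral_re_pow_complexGaussian (n : ℕ) :
    ∫ z, z.re ^ n ∂complexGaussian v = ∫ x, x ^ n ∂gaussianReal 0 (v / 2).toNNReal :=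
  (hasLaw_re_complexGaussian v).integral_comp (f := fun x => x ^ n) (by fun_prop)

lemma integral_im_pow_complexGaussian (n : ℕ) :
    ∫ z, z.im ^ n ∂complexGaussian v = ∫ x, x ^ n ∂gaussianReal 0 (v / 2).toNNReal :=
  (hasLaw_im_complexGaussian v).integral_comp (f := fun x => x ^ n) (by fun_prop)

lemma norm_sq_eq_re_sq_add_im_sq (z : ℂ) : ‖z‖ ^ 2 = z.re ^ 2 + z.im ^ 2 := by
  rw [← Complex.normSq_eq_norm_sq, Complex.normSq_apply]
  ring

lemma norm_add_sq_eq (u z : ℂ) :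
    ‖u + z‖ ^ 2 = ‖u‖ ^ 2 + (2 * u.re * z.re + 2 * u.im * z.im + (z.re ^ 2 + z.im ^ 2)) := by
  simp only [← Complex.normSq_eq_norm_sq, Complex.normSq_apply, Complex.add_re, Complex.add_im]
  ring

lemma integrable_norm_sq_complexGaussian :
    Integrable (fun z => ‖z‖ ^ 2) (complexGaussian v) := by
  have h := (integrable_re_pow_complexGaussian (v := v) 2).add
    (integrable_im_pow_complexGaussian (v := v) 2)
  refine h.congr (ae_of_all _ fun z => ?_)
  exact (norm_sq_eq_re_sq_add_im_sq z).symm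

lemma integral_norm_sq_complexGaussian (hv : 0 < v) :
    ∫ z, ‖z‖ ^ 2 ∂complexGaussian v = v := by
  simp only [norm_sq_eq_re_sq_add_im_sq]
  rw [integral_add (integrable_re_pow_complexGaussian 2) (integrable_im_pow_complexGaussian 2),
    integral_re_pow_complexGaussian, integral_im_pow_complexGaussian, integral_sq_gaussianReal,
    Real.coe_toNNReal _ (by positivity)]
  ring

lemma lintegral_norm_sq_complexGaussian (hv : 0 < v) :
    ∫⁻ z, ENNReal.ofReal (‖z‖ ^ 2) ∂complexGaussian v = ENNReal.ofReal v := by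
  rw [← ofReal_integral_eq_lintegral_ofReal integrable_norm_sq_complexGaussian
    (ae_of_all _ fun _ => by positivity), integral_norm_sq_complexGaussian hv]

lemma integral_norm_add_sq_complexGaussian (hv : 0 < v) (u : ℂ) :
    ∫ z, ‖u + z‖ ^ 2 ∂complexGaussian v = ‖u‖ ^ 2 + v := by
  have i1 : Integrable (fun z : ℂ => z.re) (complexGaussian v) := by
    simpa using integrable_re_pow_complexGaussian (v := v) 1
  have i2 : Integrable (fun z : ℂ => z.im) (complexGaussian v) := by
    simpa using integrable_im_pow_complexGaussian (v := v) 1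
  have i3 := integrable_re_pow_complexGaussian (v := v) 2
  have i4 := integrable_im_pow_complexGaussian (v := v) 2
  simp only [norm_add_sq_eq]
  rw [integral_add (integrable_const _)
      (((i1.const_mul _).fun_add (i2.const_mul _)).fun_add (i3.fun_add i4)),
    integral_add ((i1.const_mul _).fun_add (i2.const_mul _)) (i3.fun_add i4),
    integral_add (i1.const_mul _) (i2.const_mul _), integral_const_mul, integral_const_mul,
    integral_add i3 i4, integral_re_complexGaussian, integral_im_complexGaussian,
    integral_re_pow_complexGaussian, integral_im_pow_complexGaussian, integral_sq_gaussianReal,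
    Real.coe_toNNReal _ (by positivity)]
  simp

lemma memLp_norm_add_sq_complexGaussian (u : ℂ) :
    MemLp (fun z => ‖u + z‖ ^ 2) 2 (complexGaussian v) := by
  have m1 : MemLp (fun z : ℂ => z.re) 2 (complexGaussian v) :=
    (memLp_two_iff_integrable_sq (by fun_prop)).2 (integrable_re_pow_complexGaussian 2)
  have m2 : MemLp (fun z : ℂ => z.im) 2 (complexGaussian v) :=
    (memLp_two_iff_integrable_sq (by fun_prop)).2 (integrable_im_pow_complexGaussian 2)
  have m3 : MemLp (fun z : ℂ => z.re ^ 2) 2 (complexGaussian v) :=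
    (memLp_two_iff_integrable_sq (by fun_prop)).2 (by
      simpa only [← pow_mul] using integrable_re_pow_complexGaussian (v := v) 4)
  have m4 : MemLp (fun z : ℂ => z.im ^ 2) 2 (complexGaussian v) :=
    (memLp_two_iff_integrable_sq (by fun_prop)).2 (by
      simpa only [← pow_mul] using integrable_im_pow_complexGaussian (v := v) 4)
  simp only [norm_add_sq_eq]
  have m5 : MemLp (fun z : ℂ => 2 * u.re * z.re + 2 * u.im * z.im) 2 (complexGaussian v) :=
    (m1.const_mul (2 * u.re)).add (m2.const_mul (2 * u.im))
  have m6 : MemLp (fun z : ℂ => z.re ^ 2 + z.im ^ 2) 2 (complexGaussian v) := m3.add m4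
  exact (memLp_const (‖u‖ ^ 2)).add (m5.add m6)

/-- The variance of the received energy `‖u + z‖²` of one sample with signal part `u`. -/
lemma variance_norm_add_sq_complexGaussian_le (hv : 0 < v) (u : ℂ) :
    Var[fun z => ‖u + z‖ ^ 2; complexGaussian v] ≤ 8 * ‖u‖ ^ 2 * v + 194 * v ^ 2 := by
  have hm : AEMeasurable (fun z : ℂ => ‖u + z‖ ^ 2) (complexGaussian v) := by fun_prop
  rw [variance_eq_integral hm, integral_norm_add_sq_complexGaussian hv]
  have i0 : Integrable (fun z => ‖z‖ ^ 2) (complexGaussian v) := integrable_norm_sq_complexGaussian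
  have i3 := integrable_re_pow_complexGaussian (v := v) 4
  have i4 := integrable_im_pow_complexGaussian (v := v) 4
  have hpt : ∀ z : ℂ, (‖u + z‖ ^ 2 - (‖u‖ ^ 2 + v)) ^ 2 ≤
      8 * ‖u‖ ^ 2 * ‖z‖ ^ 2 + (4 * z.re ^ 4 + 4 * z.im ^ 4 + 2 * v ^ 2) := by
    intro z
    rw [norm_add_sq_eq, norm_sq_eq_re_sq_add_im_sq z, norm_sq_eq_re_sq_add_im_sq u]
    set a := u.re; set b := u.im; set x := z.re; set y := z.im
    have c1 : (a * x + b * y) ^ 2 ≤ (a ^ 2 + b ^ 2) * (x ^ 2 + y ^ 2) := by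
      nlinarith [sq_nonneg (a * y - b * x)]
    have c2 : (x ^ 2 + y ^ 2 - v) ^ 2 ≤ 2 * x ^ 4 + 2 * y ^ 4 + v ^ 2 := by
      nlinarith [sq_nonneg (x ^ 2 - y ^ 2), mul_nonneg hv.le (sq_nonneg x),
        mul_nonneg hv.le (sq_nonneg y)]
    nlinarith [sq_nonneg (2 * (a * x + b * y) - (x ^ 2 + y ^ 2 - v))]
  have hco : (((v / 2).toNNReal : ℝ≥0) : ℝ) = v / 2 := Real.coe_toNNReal _ (by positivity)
  have h4 := integral_pow_four_gaussianReal_le (w := (v / 2).toNNReal) (by simpa using hv)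
  rw [hco] at h4
  calc ∫ z, (‖u + z‖ ^ 2 - (‖u‖ ^ 2 + v)) ^ 2 ∂complexGaussian v
      ≤ ∫ z, (8 * ‖u‖ ^ 2 * ‖z‖ ^ 2 + (4 * z.re ^ 4 + 4 * z.im ^ 4 + 2 * v ^ 2))
          ∂complexGaussian v := by
        refine integral_mono_of_nonneg (ae_of_all _ fun _ => sq_nonneg _) ?_ (ae_of_all _ hpt)
        exact (i0.const_mul _).fun_add (((i3.const_mul _).fun_add (i4.const_mul _)).fun_add
          (integrable_const _))
    _ = 8 * ‖u‖ ^ 2 * v + (4 * ∫ x, x ^ 4 ∂gaussianReal 0 (v / 2).toNNReal +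
          4 * ∫ x, x ^ 4 ∂gaussianReal 0 (v / 2).toNNReal + 2 * v ^ 2) := by
        rw [integral_add (i0.const_mul _) (((i3.const_mul _).fun_add (i4.const_mul _)).fun_add
          (integrable_const _)), integral_add ((i3.const_mul _).fun_add (i4.const_mul _))
          (integrable_const _), integral_add (i3.const_mul _) (i4.const_mul _),
          integral_const_mul, integral_const_mul, integral_const_mul,
          integral_norm_sq_complexGaussian hv, integral_re_pow_complexGaussian,
          integral_im_pow_complexGaussian]
        simp
    _ ≤ 8 * ‖u‖ ^ 2 * v + 194 * v ^ 2 := by nlinarith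

end ComplexGaussian

/-! ### The channel model -/

section Model

lemma output_mul_add {Ω : Type*} {L : ℕ} {X N : ℕ → Ω → ℂ} {Θ : ℕ → Ω → ℝ}
    (m : ℕ) (l : Fin L) (ω : Ω) :
    output L X N Θ (m * L + l) ω =
      X m ω * (1 / (L : ℂ)) * Complex.exp (Complex.I * Θ (m * L + l) ω) + N (m * L + l) ω := by
  have : (m * L + l) / L = m := by
    rw [add_comm, Nat.add_mul_div_right _ _ (Fin.pos l), Nat.div_eq_of_lt l.2, zero_add]
  rw [output, this]

variable {Ω : Type*} [MeasurableSpace Ω] {μ : Measure Ω}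
  {β P σ2 : ℝ} {L : ℕ} {X N : ℕ → Ω → ℂ} {Θ W : ℕ → Ω → ℝ}

/-- The law of a sequence of i.i.d. random elements is invariant under shifts. -/
lemma measurePreserving_shift {S : Type*} [MeasurableSpace S] {Z : ℕ → Ω → S}
    (hZ : ∀ k, Measurable (Z k)) (hind : iIndepFun Z μ) {ν : Measure S}
    (hlaw : ∀ k, μ.map (Z k) = ν) (n : ℕ) :
    MeasurePreserving (fun (z : ℕ → S) (k : ℕ) => z (n + k)) (μ.map fun ω k => Z k ω)
      (μ.map fun ω k => Z k ω) := by
  have hs : Measurable fun (z : ℕ → S) (k : ℕ) => z (n + k) :=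
    measurable_pi_lambda _ fun k => measurable_pi_apply _
  refine ⟨hs, ?_⟩
  rw [Measure.map_map hs (measurable_pi_lambda _ hZ)]
  have h := hind.precomp (g := fun k => n + k) (add_right_injective n)
  have h1 := h.map_fun_eq_infinitePi_map fun k => hZ (n + k)
  have h2 := hind.map_fun_eq_infinitePi_map hZ
  simp only [hlaw] at h1 h2
  exact h1.trans h2.symm

lemma IsWienerPhase.measurable (h : IsWienerPhase μ β L Θ W) (k : ℕ) : Measurable (Θ k) := by
  induction k with
  | zero => exact h.measurable_init
  | succ k ih =>
    have : Θ (k + 1) = fun ω => Θ k ω + W k ω := funext (h.step k)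
    rw [this]
    exact ih.add (h.measurable_incr k)

lemma IsWienerPhase.eq_add_sum (h : IsWienerPhase μ β L Θ W) (k : ℕ) (ω : Ω) :
    Θ k ω = Θ 0 ω + ∑ i ∈ Finset.range k, W i ω := by
  induction k with
  | zero => simp
  | succ k ih => rw [h.step, ih, Finset.sum_range_succ, add_assoc]

namespace IsModel

lemma measurable_X (h : IsModel μ β P σ2 L X N Θ W) : Measurable fun ω k => X k ω :=
  measurable_pi_lambda _ h.input.measurable

lemma measurable_N (h : IsModel μ β P σ2 L X N Θ W) : Measurable fun ω k => N k ω :=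
  measurable_pi_lambda _ h.noise.measurable

lemma measurable_Θ (h : IsModel μ β P σ2 L X N Θ W) : Measurable fun ω k => Θ k ω :=
  measurable_pi_lambda _ h.phase.measurable

lemma measurable_output (h : IsModel μ β P σ2 L X N Θ W) (k : ℕ) :
    Measurable (output L X N Θ k) := by
  have h1 := h.input.measurable
  have h2 := h.noise.measurable k
  have h3 := h.phase.measurable k
  unfold output
  fun_prop

lemma measurable_inputBlock (h : IsModel μ β P σ2 L X N Θ W) (n : ℕ) :
    Measurable (inputBlock X n) :=
  measurable_pi_lambda _ fun m => h.input.measurable m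

lemma measurable_outputBlock (h : IsModel μ β P σ2 L X N Θ W) (n : ℕ) :
    Measurable (outputBlock L X N Θ n) :=
  measurable_pi_lambda _ fun _ => measurable_pi_lambda _ fun _ => h.measurable_output _

end IsModel

variable [IsProbabilityMeasure μ]

/-- The phases modulo `2π` form a stationary process: the initial phase is uniform, hence so is the
phase at any later time, and it stays independent of the increments that follow. -/
lemma IsWienerPhase.lintegral_shift (h : IsWienerPhase μ β L Θ W) (m : ℕ)
    {G : (ℕ → ℂ) → ℝ≥0∞} (hG : Measurable G) :
    ∫⁻ ω, G (fun k => Complex.exp (Complex.I * Θ (m + k) ω)) ∂μ =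
      ∫⁻ ω, G (fun k => Complex.exp (Complex.I * Θ k ω)) ∂μ := by
  have hWm : Measurable fun ω k => W k ω := measurable_pi_lambda _ h.measurable_incr
  have hjoint := (indepFun_iff_map_prod_eq_prod_map_map h.measurable_init.aemeasurable
    hWm.aemeasurable).1 h.indep_init_incr
  rw [h.law_init.map_eq] at hjoint
  -- Both sides are integrals over the increments and the uniform initial phase.
  have key : ∀ m : ℕ, ∫⁻ ω, G (fun k => Complex.exp (Complex.I * Θ (m + k) ω)) ∂μ =
      ∫⁻ w, ∫⁻ φ, G (fun k => Complex.exp (Complex.I * φ) *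
        Complex.exp (Complex.I * ((∑ i ∈ Finset.range k, w (m + i) : ℝ) : ℂ)))
        ∂uniformAngle ∂(μ.map fun ω k => W k ω) := by
    intro m
    have hF : Measurable fun p : ℝ × (ℕ → ℝ) => G (fun k => Complex.exp (Complex.I *
        ((p.1 + ∑ i ∈ Finset.range (m + k), p.2 i : ℝ) : ℂ))) := by
      refine hG.comp (measurable_pi_lambda _ fun k => ?_)
      fun_prop
    calc ∫⁻ ω, G (fun k => Complex.exp (Complex.I * Θ (m + k) ω)) ∂μ
        = ∫⁻ p, G (fun k => Complex.exp (Complex.I *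
            ((p.1 + ∑ i ∈ Finset.range (m + k), p.2 i : ℝ) : ℂ)))
            ∂(uniformAngle.prod (μ.map fun ω k => W k ω)) := by
          rw [← hjoint, lintegral_map hF (h.measurable_init.prodMk hWm)]
          simp only [← h.eq_add_sum]
      _ = ∫⁻ w, ∫⁻ φ, G (fun k => Complex.exp (Complex.I *
            ((φ + ∑ i ∈ Finset.range (m + k), w i : ℝ) : ℂ)))
            ∂uniformAngle ∂(μ.map fun ω k => W k ω) := lintegral_prod_symm' _ hF
      _ = _ := by
          refine lintegral_congr fun w => ?_
          rw [← lintegral_uniformAngle_add (periodic_comp_exp_I fun c => G (fun k => c *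
            Complex.exp (Complex.I * ((∑ i ∈ Finset.range k, w (m + i) : ℝ) : ℂ))))
            (∑ i ∈ Finset.range m, w i)]
          refine lintegral_congr fun φ => ?_
          congr 1
          ext k
          rw [← Complex.exp_add, Finset.sum_range_add]
          congr 1
          push_cast
          ring
  have hshift := measurePreserving_shift h.measurable_incr h.iIndep
    (fun k => (h.law_incr k).map_eq) m
  have hm : Measurable fun w : ℕ → ℝ => ∫⁻ φ, G (fun k => Complex.exp (Complex.I * φ) *
      Complex.exp (Complex.I * ((∑ i ∈ Finset.range k, w i : ℝ) : ℂ))) ∂uniformAngle := by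
    refine Measurable.lintegral_prod_left' (f := fun p : ℝ × (ℕ → ℝ) => G (fun k =>
      Complex.exp (Complex.I * p.1) *
        Complex.exp (Complex.I * ((∑ i ∈ Finset.range k, p.2 i : ℝ) : ℂ)))) ?_
    refine hG.comp (measurable_pi_lambda _ fun k => ?_)
    fun_prop
  have h0 := key 0
  simp only [zero_add] at h0
  rw [key m, h0]
  exact hshift.lintegral_comp hm

namespace IsModel

/-- Expectations in the channel model are iterated integrals over input, phase and noise. -/
lemma lintegral_eq (h : IsModel μ β P σ2 L X N Θ W)
    {F : (ℕ → ℂ) → (ℕ → ℝ) → (ℕ → ℂ) → ℝ≥0∞}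
    (hF : Measurable fun p : (ℕ → ℂ) × (ℕ → ℝ) × (ℕ → ℂ) => F p.1 p.2.1 p.2.2) :
    ∫⁻ ω, F (fun k => X k ω) (fun k => Θ k ω) (fun k => N k ω) ∂μ =
      ∫⁻ x, ∫⁻ θ, ∫⁻ z, F x θ z ∂(μ.map fun ω k => N k ω) ∂(μ.map fun ω k => Θ k ω)
        ∂(μ.map fun ω k => X k ω) := by
  have hX := h.measurable_X
  have hN := h.measurable_N
  have hΘ := h.measurable_Θ
  have h1 := (indepFun_iff_map_prod_eq_prod_map_map hX.aemeasurable
    (hN.prodMk hΘ).aemeasurable).1 h.indep_input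
  rw [(indepFun_iff_map_prod_eq_prod_map_map hN.aemeasurable hΘ.aemeasurable).1
    h.indep_noise_phase] at h1
  have hF' : Measurable fun p : (ℕ → ℂ) × (ℕ → ℂ) × (ℕ → ℝ) => F p.1 p.2.2 p.2.1 :=
    hF.comp (g := fun p : (ℕ → ℂ) × (ℕ → ℝ) × (ℕ → ℂ) => F p.1 p.2.1 p.2.2)
      (f := fun p : (ℕ → ℂ) × (ℕ → ℂ) × (ℕ → ℝ) => (p.1, p.2.2, p.2.1)) (by fun_prop)
  calc ∫⁻ ω, F (fun k => X k ω) (fun k => Θ k ω) (fun k => N k ω) ∂μ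
      = ∫⁻ p, F p.1 p.2.2 p.2.1 ∂((μ.map fun ω k => X k ω).prod
          ((μ.map fun ω k => N k ω).prod (μ.map fun ω k => Θ k ω))) := by
        rw [← h1, lintegral_map hF' (hX.prodMk (hN.prodMk hΘ))]
    _ = _ := by
        rw [lintegral_prod _ hF'.aemeasurable]
        refine lintegral_congr fun x => ?_
        exact lintegral_prod_symm' _ (hF'.comp (measurable_prodMk_left (x := x)))

/-- The signal, that is, input and phase together, is independent of the additive noise. -/
lemma indepFun_signal_noise (h : IsModel μ β P σ2 L X N Θ W) :
    IndepFun (fun ω => (fun k => X k ω, fun k => Θ k ω)) (fun ω k => N k ω) μ := by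
  have hX := h.measurable_X
  have hN := h.measurable_N
  have hΘ := h.measurable_Θ
  rw [indepFun_iff_map_prod_eq_prod_map_map (hX.prodMk hΘ).aemeasurable hN.aemeasurable]
  refine Measure.ext_of_lintegral _ fun f hf => ?_
  rw [lintegral_map hf ((hX.prodMk hΘ).prodMk hN), lintegral_prod _ hf.aemeasurable,
    lintegral_map hf.lintegral_prod_right' (hX.prodMk hΘ),
    h.lintegral_eq (F := fun x θ z => f ((x, θ), z)) (by fun_prop),
    h.lintegral_eq (F := fun x θ _ => ∫⁻ z, f ((x, θ), z) ∂(μ.map fun ω k => N k ω))]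
  · have := Measure.isProbabilityMeasure_map (μ := μ) hN.aemeasurable
    simp
  · exact hf.lintegral_prod_right'.comp (g := fun p : (ℕ → ℂ) × (ℕ → ℝ) =>
      ∫⁻ z, f (p, z) ∂(μ.map fun ω k => N k ω))
      (f := fun p : (ℕ → ℂ) × (ℕ → ℝ) × (ℕ → ℂ) => (p.1, p.2.1)) (by fun_prop)

/-- The joint law of input and output blocks is stationary. -/
lemma map_block_shift (h : IsModel μ β P σ2 L X N Θ W) (n m : ℕ) :
    μ.map (fun ω => (fun j : Fin m => X (n + j) ω,
        fun (j : Fin m) (l : Fin L) => output L X N Θ ((n + j) * L + l) ω)) =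
      μ.map (fun ω => (inputBlock X m ω, outputBlock L X N Θ m ω)) := by
  have hΘ := h.measurable_Θ
  have mX := h.input.measurable
  have mO := h.measurable_output
  refine Measure.ext_of_lintegral _ fun f hf => ?_
  rw [lintegral_map hf ((h.measurable_inputBlock m).prodMk (h.measurable_outputBlock m)),
    lintegral_map hf (by fun_prop)]
  set G : (ℕ → ℂ) → (ℕ → ℂ) → (ℕ → ℂ) → ℝ≥0∞ := fun x e z =>
    f (fun j : Fin m => x j,
      fun (j : Fin m) (l : Fin L) => x j * (1 / (L : ℂ)) * e (j * L + l) + z (j * L + l)) with hG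
  have hGm : Measurable fun p : (ℕ → ℂ) × (ℕ → ℂ) × (ℕ → ℂ) => G p.1 p.2.1 p.2.2 := by
    refine hf.comp (Measurable.prodMk (by fun_prop) ?_)
    refine measurable_pi_lambda _ fun j => measurable_pi_lambda _ fun l => ?_
    fun_prop
  have hexp : Measurable fun (θ : ℕ → ℝ) (k : ℕ) => Complex.exp (Complex.I * θ k) :=
    measurable_pi_lambda _ fun k => by fun_prop
  have hsX := measurePreserving_shift h.input.measurable h.input.iIndep
    (fun k => (h.input.identDistrib k).map_eq) n
  have hsN := measurePreserving_shift h.noise.measurable h.noise.iIndep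
    (fun k => (h.noise.law k).map_eq) (n * L)
  have hsΘ : Measurable fun (θ : ℕ → ℝ) (k : ℕ) => Complex.exp (Complex.I * θ (n * L + k)) :=
    measurable_pi_lambda _ fun k => by fun_prop
  calc ∫⁻ ω, f (fun j : Fin m => X (n + j) ω,
        fun (j : Fin m) (l : Fin L) => output L X N Θ ((n + j) * L + l) ω) ∂μ
      = ∫⁻ ω, G (fun k => X (n + k) ω) (fun k => Complex.exp (Complex.I * Θ (n * L + k) ω))
          (fun k => N (n * L + k) ω) ∂μ := by
        refine lintegral_congr fun ω => ?_
        simp only [hG]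
        congr 2
        ext j l
        rw [output_mul_add, add_mul, add_assoc]
    _ = ∫⁻ x, ∫⁻ θ, ∫⁻ z, G (fun k => x (n + k))
          (fun k => Complex.exp (Complex.I * θ (n * L + k))) (fun k => z (n * L + k))
          ∂(μ.map fun ω k => N k ω) ∂(μ.map fun ω k => Θ k ω) ∂(μ.map fun ω k => X k ω) := by
        refine h.lintegral_eq (F := fun x θ z => G (fun k => x (n + k))
          (fun k => Complex.exp (Complex.I * θ (n * L + k))) (fun k => z (n * L + k))) ?_
        exact hGm.comp (g := fun p : (ℕ → ℂ) × (ℕ → ℂ) × (ℕ → ℂ) => G p.1 p.2.1 p.2.2)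
          (f := fun p : (ℕ → ℂ) × (ℕ → ℝ) × (ℕ → ℂ) => ((fun k => p.1 (n + k)),
            (fun k => Complex.exp (Complex.I * p.2.1 (n * L + k))), fun k => p.2.2 (n * L + k)))
          (by fun_prop)
    _ = ∫⁻ x, ∫⁻ θ, ∫⁻ z, G x (fun k => Complex.exp (Complex.I * θ k)) z
          ∂(μ.map fun ω k => N k ω) ∂(μ.map fun ω k => Θ k ω) ∂(μ.map fun ω k => X k ω) := by
        -- Noise, phase and input can be shifted back one after the other.
        have eN : ∀ x e, ∫⁻ z, G x e (fun k => z (n * L + k)) ∂(μ.map fun ω k => N k ω) =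
            ∫⁻ z, G x e z ∂(μ.map fun ω k => N k ω) := by
          intro x e
          have hm : Measurable (G x e) :=
            hGm.comp ((measurable_prodMk_left (x := x)).comp (measurable_prodMk_left (x := e)))
          exact hsN.lintegral_comp hm
        set H : (ℕ → ℂ) → (ℕ → ℂ) → ℝ≥0∞ := fun x e => ∫⁻ z, G x e z ∂(μ.map fun ω k => N k ω)
        have hHm : Measurable fun p : (ℕ → ℂ) × (ℕ → ℂ) => H p.1 p.2 :=
          Measurable.lintegral_prod_right' (f := fun q : ((ℕ → ℂ) × (ℕ → ℂ)) × (ℕ → ℂ) =>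
            G q.1.1 q.1.2 q.2) (hGm.comp (g := fun p : (ℕ → ℂ) × (ℕ → ℂ) × (ℕ → ℂ) =>
              G p.1 p.2.1 p.2.2) (f := fun q : ((ℕ → ℂ) × (ℕ → ℂ)) × (ℕ → ℂ) =>
                (q.1.1, q.1.2, q.2)) (by fun_prop))
        have eΘ : ∀ x, ∫⁻ θ, H x (fun k => Complex.exp (Complex.I * θ (n * L + k)))
            ∂(μ.map fun ω k => Θ k ω) =
            ∫⁻ θ, H x (fun k => Complex.exp (Complex.I * θ k)) ∂(μ.map fun ω k => Θ k ω) := by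
          intro x
          have hm : Measurable (H x) := hHm.comp (measurable_prodMk_left (x := x))
          refine (lintegral_map (hm.comp hsΘ) hΘ).trans (Eq.trans ?_
            (lintegral_map (hm.comp hexp) hΘ).symm)
          exact h.phase.lintegral_shift (n * L) hm
        simp only [eN]
        change ∫⁻ x, ∫⁻ θ, H (fun k => x (n + k)) (fun k => Complex.exp (Complex.I * θ (n * L + k)))
          ∂(μ.map fun ω k => Θ k ω) ∂(μ.map fun ω k => X k ω) = ∫⁻ x, ∫⁻ θ, H x
            (fun k => Complex.exp (Complex.I * θ k)) ∂(μ.map fun ω k => Θ k ω)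
            ∂(μ.map fun ω k => X k ω)
        simp only [eΘ]
        have hm : Measurable fun x => ∫⁻ θ, H x (fun k => Complex.exp (Complex.I * θ k))
            ∂(μ.map fun ω k => Θ k ω) :=
          Measurable.lintegral_prod_right' (f := fun q : (ℕ → ℂ) × (ℕ → ℝ) =>
            H q.1 (fun k => Complex.exp (Complex.I * q.2 k))) (hHm.comp
              (g := fun p : (ℕ → ℂ) × (ℕ → ℂ) => H p.1 p.2) (f := fun q : (ℕ → ℂ) × (ℕ → ℝ) =>
                (q.1, fun k => Complex.exp (Complex.I * q.2 k))) (by fun_prop))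
        exact hsX.lintegral_comp hm
    _ = ∫⁻ ω, G (fun k => X k ω) (fun k => Complex.exp (Complex.I * Θ k ω))
          (fun k => N k ω) ∂μ := by
        refine (h.lintegral_eq (F := fun x θ z => G x
          (fun k => Complex.exp (Complex.I * θ k)) z) ?_).symm
        exact hGm.comp (g := fun p : (ℕ → ℂ) × (ℕ → ℂ) × (ℕ → ℂ) => G p.1 p.2.1 p.2.2)
          (f := fun p : (ℕ → ℂ) × (ℕ → ℝ) × (ℕ → ℂ) => (p.1,
            (fun k => Complex.exp (Complex.I * p.2.1 k)), p.2.2)) (by fun_prop)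
    _ = ∫⁻ ω, f (inputBlock X m ω, outputBlock L X N Θ m ω) ∂μ := by
        refine lintegral_congr fun ω => ?_
        simp only [hG]
        congr 2
        ext j l
        rw [outputBlock, output_mul_add]

/-- Superadditivity of the block mutual information in the block length. -/
lemma mutualInfo_add_le (h : IsModel μ β P σ2 L X N Θ W)
    (hfin : ∀ n, mutualInfo μ (inputBlock X n) (outputBlock L X N Θ n) ≠ ∞) (n m : ℕ) :
    mutualInfo μ (inputBlock X n) (outputBlock L X N Θ n) +
        mutualInfo μ (inputBlock X m) (outputBlock L X N Θ m) ≤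
      mutualInfo μ (inputBlock X (n + m)) (outputBlock L X N Θ (n + m)) := by
  have mX := h.input.measurable
  have mO := h.measurable_output
  set A' : Ω → Fin m → ℂ := fun ω j => X (n + j) ω with hA'
  set B' : Ω → Fin m → Fin L → ℂ := fun ω j l => output L X N Θ ((n + j) * L + l) ω with hB'
  have hA'm : Measurable A' := measurable_pi_lambda _ fun j => mX _
  have hB'm : Measurable B' :=
    measurable_pi_lambda _ fun j => measurable_pi_lambda _ fun l => mO _
  have hcongr : mutualInfo μ A' B' = mutualInfo μ (inputBlock X m) (outputBlock L X N Θ m) :=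
    mutualInfo_congr_law hA'm hB'm (h.measurable_inputBlock m) (h.measurable_outputBlock m)
      (h.map_block_shift n m)
  have hind : IndepFun (inputBlock X n) A' μ := by
    have h0 := h.input.iIndep.indepFun_finset (Finset.range n) (Finset.Ico n (n + m))
      (by
        rw [Finset.disjoint_left]
        intro a ha hb
        simp only [Finset.mem_range, Finset.mem_Ico] at ha hb
        omega) mX
    exact h0.comp
      (φ := fun (x : (i : Finset.range n) → ℂ) (i : Fin n) => x ⟨i, by simp⟩)
      (ψ := fun (x : (i : Finset.Ico n (n + m)) → ℂ) (j : Fin m) => x ⟨n + j, by simp⟩)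
      (by fun_prop) (by fun_prop)
  have h1 := add_mutualInfo_le (h.measurable_inputBlock n) (h.measurable_outputBlock n) hA'm hB'm
    hind (hfin n) (by rw [hcongr]; exact hfin m)
  rw [hcongr] at h1
  refine h1.trans ?_
  exact mutualInfo_comp_le (h.measurable_inputBlock (n + m)) (h.measurable_outputBlock (n + m))
    (f := fun x : Fin (n + m) → ℂ => (fun i => x (Fin.castAdd m i), fun j => x (Fin.natAdd n j)))
    (g := fun y : Fin (n + m) → Fin L → ℂ =>
      (fun i => y (Fin.castAdd m i), fun j => y (Fin.natAdd n j)))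
    (by fun_prop) (by fun_prop)

end IsModel

end Model

/-! ### Finiteness of the mutual information over an additive Gaussian channel -/

section AdditiveNoise

open Real

variable {ι : Type*} [Fintype ι]

lemma pi_withDensity_ofReal {E : Type*} [MeasureSpace E] [SigmaFinite (volume : Measure E)]
    {φ : E → ℝ} (hφ : Integrable φ) (hφ0 : ∀ x, 0 ≤ φ x) :
    Measure.pi (fun _ : ι => (volume : Measure E).withDensity fun x => ENNReal.ofReal (φ x)) =
      (volume : Measure (ι → E)).withDensity fun x => ENNReal.ofReal (∏ i, φ (x i)) := by
  have : SigmaFinite ((volume : Measure E).withDensity fun x => ENNReal.ofReal (φ x)) :=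
    inferInstance
  refine Measure.pi_eq fun s hs => ?_
  have hbox : MeasurableSet (Set.univ.pi s) := MeasurableSet.univ_pi hs
  have hprod : ∀ x : ι → E, (Set.univ.pi s).indicator (fun x => ENNReal.ofReal (∏ i, φ (x i))) x =
      ENNReal.ofReal (∏ i, (s i).indicator φ (x i)) := by
    intro x
    by_cases hx : x ∈ Set.univ.pi s
    · rw [Set.indicator_of_mem hx]
      congr 1
      exact Finset.prod_congr rfl fun i _ => (Set.indicator_of_mem (hx i (Set.mem_univ i)) φ).symm
    · rw [Set.indicator_of_notMem hx]
      obtain ⟨i, hi⟩ : ∃ i, x i ∉ s i := by simpa [Set.mem_pi] using hx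
      rw [Finset.prod_eq_zero (Finset.mem_univ i) (Set.indicator_of_notMem hi φ),
        ENNReal.ofReal_zero]
  have hint : ∀ i, Integrable ((s i).indicator φ) := fun i => hφ.indicator (hs i)
  have h0 : ∀ i x, 0 ≤ (s i).indicator φ x := fun i x => Set.indicator_nonneg (fun y _ => hφ0 y) x
  rw [withDensity_apply _ hbox, ← lintegral_indicator hbox]
  simp only [hprod]
  have hpi : Integrable fun x : ι → E => ∏ i, (s i).indicator φ (x i) :=
    Integrable.fintype_prod hint
  rw [← ofReal_integral_eq_lintegral_ofReal hpi
      (ae_of_all _ fun x => Finset.prod_nonneg fun i _ => h0 i _),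
    integral_fintype_prod_volume_eq_prod,
    ENNReal.ofReal_prod_of_nonneg fun i _ => integral_nonneg (h0 i)]
  refine Finset.prod_congr rfl fun i _ => ?_
  rw [withDensity_apply _ (hs i), ofReal_integral_eq_lintegral_ofReal (hint i)
    (ae_of_all _ (h0 i)), ← lintegral_indicator (hs i)]
  refine lintegral_congr fun x => ?_
  by_cases hx : x ∈ s i <;> simp [hx]

lemma pi_complexGaussian_eq_withDensity {v : ℝ} (hv : 0 < v) :
    Measure.pi (fun _ : ι => complexGaussian v) = (volume : Measure (ι → ℂ)).withDensity fun z =>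
      ENNReal.ofReal (((π * v)⁻¹) ^ Fintype.card ι * rexp (-(∑ i, ‖z i‖ ^ 2) / v)) := by
  have hm : Measurable fun z : ℂ => (π * v)⁻¹ * rexp (-‖z‖ ^ 2 / v) := by fun_prop
  have h0 : ∀ z : ℂ, 0 ≤ (π * v)⁻¹ * rexp (-‖z‖ ^ 2 / v) := fun z => by positivity
  have hint : Integrable fun z : ℂ => (π * v)⁻¹ * rexp (-‖z‖ ^ 2 / v) := by
    refine (lintegral_ofReal_ne_top_iff_integrable hm.aestronglyMeasurable (ae_of_all _ h0)).1 ?_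
    have h : ∫⁻ z, complexGaussianPDF v z = 1 := by
      have := measure_univ (μ := complexGaussian v)
      rwa [complexGaussian_eq_withDensity hv, withDensity_apply _ MeasurableSet.univ,
        Measure.restrict_univ] at this
    exact h.trans_ne ENNReal.one_ne_top
  rw [complexGaussian_eq_withDensity hv]
  refine (pi_withDensity_ofReal hint h0).trans ?_
  congr 1
  ext z
  rw [Finset.prod_mul_distrib, Finset.prod_const, ← exp_sum, ← Finset.sum_div,
    Finset.sum_neg_distrib]
  rfl

variable {Ω S : Type*} [MeasurableSpace Ω] [MeasurableSpace S] {μ : Measure Ω}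
  [IsProbabilityMeasure μ]

/-- The mutual information over an additive Gaussian channel is bounded in terms of the energy `c`
of the signal `U`. The conditional density of the output is at most `M = (π v)^{-|ι|}`, and the
density of the output at `y` is at least `M exp (-(2 |y|² + 4 c) / v) / 2`, because the energy of
the signal is at most `2 c` with probability at least `1 / 2`. -/
lemma mutualInfo_add_noise_le {v c : ℝ} (hv : 0 < v) (hc : 0 < c) {A : Ω → S} {U Z : Ω → ι → ℂ}
    (hA : Measurable A) (hU : Measurable U) (hZ : Measurable Z)
    (hind : IndepFun (fun ω => (A ω, U ω)) Z μ)
    (hlaw : μ.map Z = Measure.pi fun _ => complexGaussian v)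
    (henergy : ∫⁻ ω, ENNReal.ofReal (∑ i, ‖U ω i‖ ^ 2) ∂μ ≤ ENNReal.ofReal c) :
    mutualInfo μ A (fun ω i => U ω i + Z ω i) ≤ ∫⁻ ω, ENNReal.ofReal
      ((2 * ∑ i, ‖U ω i + Z ω i‖ ^ 2 + 4 * c) / v + log 2) ∂μ + 1 := by
  set Y : Ω → ι → ℂ := fun ω i => U ω i + Z ω i with hYdef
  have hY : Measurable Y := by
    refine measurable_pi_lambda _ fun i => ?_
    fun_prop
  have := Measure.isProbabilityMeasure_map (μ := μ) hA.aemeasurable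
  have := Measure.isProbabilityMeasure_map (μ := μ) hY.aemeasurable
  have := Measure.isProbabilityMeasure_map (μ := μ) (hA.prodMk hY).aemeasurable
  set M : ℝ := ((π * v)⁻¹) ^ Fintype.card ι with hM
  have hM0 : 0 < M := by positivity
  set φ : (ι → ℂ) → ℝ≥0∞ := fun z => ENNReal.ofReal (M * rexp (-(∑ i, ‖z i‖ ^ 2) / v)) with hφ
  have hφm : Measurable φ := by fun_prop
  set g : (ι → ℂ) → ℝ := fun y => (2 * ∑ i, ‖y i‖ ^ 2 + 4 * c) / v + log 2 with hg
  have hgm : Measurable g := by fun_prop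
  have hg0 : ∀ y, 0 ≤ g y := fun y => by
    positivity
  -- Expectations over signal and output, in terms of the conditional density of the output.
  have hlint : ∀ {f : S × (ι → ℂ) → ℝ≥0∞}, Measurable f → ∫⁻ ω, f (A ω, Y ω) ∂μ =
      ∫⁻ ω, ∫⁻ y, φ (y - U ω) * f (A ω, y) ∂volume ∂μ := by
    intro f hf
    have hjoint := (indepFun_iff_map_prod_eq_prod_map_map (hA.prodMk hU).aemeasurable
      hZ.aemeasurable).1 hind
    have hF : Measurable fun p : (S × (ι → ℂ)) × (ι → ℂ) => f (p.1.1, p.1.2 + p.2) := by fun_prop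
    calc ∫⁻ ω, f (A ω, Y ω) ∂μ
        = ∫⁻ p, f (p.1.1, p.1.2 + p.2) ∂((μ.map fun ω => (A ω, U ω)).prod (μ.map Z)) := by
          rw [← hjoint, lintegral_map hF ((hA.prodMk hU).prodMk hZ)]
          rfl
      _ = ∫⁻ ω, ∫⁻ z, f (A ω, U ω + z) ∂(μ.map Z) ∂μ := by
          rw [lintegral_prod _ hF.aemeasurable,
            lintegral_map hF.lintegral_prod_right' (hA.prodMk hU)]
      _ = ∫⁻ ω, ∫⁻ y, φ (y - U ω) * f (A ω, y) ∂volume ∂μ := by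
          refine lintegral_congr fun ω => ?_
          rw [hlaw, pi_complexGaussian_eq_withDensity hv,
            lintegral_withDensity_eq_lintegral_mul _ hφm (by fun_prop),
            ← lintegral_sub_right_eq_self _ (U ω)]
          refine lintegral_congr fun y => ?_
          simp [hφ]
  have hφle : ∀ z, φ z ≤ ENNReal.ofReal M := fun z => by
    refine ENNReal.ofReal_le_ofReal (mul_le_of_le_one_right hM0.le (exp_le_one_iff.2 ?_))
    exact div_nonpos_of_nonpos_of_nonneg (neg_nonpos.2 (by positivity)) hv.le
  have hsm : Measurable fun ω => ENNReal.ofReal (∑ i, ‖U ω i‖ ^ 2) := by fun_prop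
  -- Markov's inequality for the energy of the signal.
  have hmarkov : (1 / 2 : ℝ≥0∞) ≤ μ {ω | ∑ i, ‖U ω i‖ ^ 2 < 2 * c} := by
    have h1 := (mul_meas_ge_le_lintegral (μ := μ) hsm (ENNReal.ofReal (2 * c))).trans henergy
    have hset : {ω | ENNReal.ofReal (2 * c) ≤ ENNReal.ofReal (∑ i, ‖U ω i‖ ^ 2)} =
        {ω | ∑ i, ‖U ω i‖ ^ 2 < 2 * c}ᶜ := by
      ext ω
      simp only [Set.mem_ofPred_eq, Set.mem_compl_iff, not_lt]
      exact ENNReal.ofReal_le_ofReal_iff (by positivity)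
    have hms : MeasurableSet {ω | ∑ i, ‖U ω i‖ ^ 2 < 2 * c} :=
      measurableSet_lt (by fun_prop) measurable_const
    have hc0 : ENNReal.ofReal c ≠ 0 := by simpa using hc
    rw [hset, prob_compl_eq_one_sub hms, ENNReal.ofReal_mul zero_le_two, ENNReal.ofReal_ofNat]
      at h1
    have h2 : (2 : ℝ≥0∞) * (1 - μ {ω | ∑ i, ‖U ω i‖ ^ 2 < 2 * c}) ≤ 1 := by
      have h3 : ENNReal.ofReal c * (2 * (1 - μ {ω | ∑ i, ‖U ω i‖ ^ 2 < 2 * c})) ≤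
          ENNReal.ofReal c * 1 := by
        rw [mul_one]
        refine le_trans (le_of_eq ?_) h1
        ring
      exact (ENNReal.mul_le_mul_iff_right hc0 ENNReal.ofReal_ne_top).1 h3
    have h4 : 1 - μ {ω | ∑ i, ‖U ω i‖ ^ 2 < 2 * c} ≤ 1 / 2 := by
      rw [ENNReal.le_div_iff_mul_le (by simp) (by simp), mul_comm]
      exact h2
    have h5 : (1 : ℝ≥0∞) ≤ 1 / 2 + μ {ω | ∑ i, ‖U ω i‖ ^ 2 < 2 * c} :=
      tsub_le_iff_right.1 h4
    have h6 : (1 : ℝ≥0∞) = 1 / 2 + 1 / 2 := (ENNReal.add_halves 1).symm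
    nth_rewrite 1 [h6] at h5
    exact (ENNReal.add_le_add_iff_left (by simp)).1 h5
  have hdens : ∀ y, ENNReal.ofReal M ≤
      ENNReal.ofReal (rexp (g y)) * ∫⁻ ω, φ (y - U ω) ∂μ := by
    intro y
    have hlow : ENNReal.ofReal (M * rexp (-(2 * ∑ i, ‖y i‖ ^ 2 + 4 * c) / v)) * (1 / 2) ≤
        ∫⁻ ω, φ (y - U ω) ∂μ := by
      calc ENNReal.ofReal (M * rexp (-(2 * ∑ i, ‖y i‖ ^ 2 + 4 * c) / v)) * (1 / 2)
          ≤ ENNReal.ofReal (M * rexp (-(2 * ∑ i, ‖y i‖ ^ 2 + 4 * c) / v)) *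
              μ {ω | ∑ i, ‖U ω i‖ ^ 2 < 2 * c} := by gcongr
        _ = ∫⁻ ω in {ω | ∑ i, ‖U ω i‖ ^ 2 < 2 * c},
              ENNReal.ofReal (M * rexp (-(2 * ∑ i, ‖y i‖ ^ 2 + 4 * c) / v)) ∂μ := by
            rw [setLIntegral_const]
        _ ≤ ∫⁻ ω in {ω | ∑ i, ‖U ω i‖ ^ 2 < 2 * c}, φ (y - U ω) ∂μ := by
            refine setLIntegral_mono (by fun_prop) fun ω hω => ENNReal.ofReal_le_ofReal ?_
            have hpar : ∑ i, ‖(y - U ω) i‖ ^ 2 ≤ 2 * ∑ i, ‖y i‖ ^ 2 + 2 * ∑ i, ‖U ω i‖ ^ 2 := by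
              rw [Finset.mul_sum, Finset.mul_sum, ← Finset.sum_add_distrib]
              refine Finset.sum_le_sum fun i _ => ?_
              have h := norm_sub_le (y i) (U ω i)
              rw [Pi.sub_apply]
              nlinarith [norm_nonneg (y i - U ω i), sq_nonneg (‖y i‖ - ‖U ω i‖)]
            have hω' : ∑ i, ‖U ω i‖ ^ 2 < 2 * c := hω
            gcongr
            linarith
        _ ≤ ∫⁻ ω, φ (y - U ω) ∂μ := setLIntegral_le_lintegral _ _
    refine le_trans (le_of_eq ?_) (mul_le_mul_right hlow _)
    have h2 : (1 / 2 : ℝ≥0∞) = ENNReal.ofReal (1 / 2) := by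
      rw [ENNReal.ofReal_div_of_pos two_pos]; simp
    rw [h2, ← ENNReal.ofReal_mul (by positivity), ← ENNReal.ofReal_mul (by positivity)]
    congr 1
    have e : rexp (g y) * rexp (-(2 * ∑ i, ‖y i‖ ^ 2 + 4 * c) / v) = 2 := by
      rw [← exp_add, hg, neg_div]
      simp only
      rw [add_comm _ (log 2), add_assoc, add_neg_cancel, add_zero, exp_log two_pos]
    linear_combination (-M / 2) * e
  -- The conditional density of the output is at most `exp g` times its density.
  have hdom : μ.map (fun ω => (A ω, Y ω)) ≤ ((μ.map A).prod (μ.map Y)).withDensity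
      fun p => ENNReal.ofReal (rexp (g p.2)) := by
    refine Measure.le_iff.2 fun s hs => ?_
    have hsi : Measurable (s.indicator (1 : S × (ι → ℂ) → ℝ≥0∞)) := measurable_one.indicator hs
    have hgi : Measurable fun p : S × (ι → ℂ) =>
        ENNReal.ofReal (rexp (g p.2)) * s.indicator 1 p := by fun_prop
    calc μ.map (fun ω => (A ω, Y ω)) s
        = ∫⁻ ω, s.indicator 1 (A ω, Y ω) ∂μ := by
          rw [← lintegral_map hsi (hA.prodMk hY), lintegral_indicator_one hs]
      _ = ∫⁻ ω, ∫⁻ y, φ (y - U ω) * s.indicator 1 (A ω, y) ∂volume ∂μ := hlint hsi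
      _ ≤ ∫⁻ ω, ∫⁻ y, ENNReal.ofReal M * s.indicator 1 (A ω, y) ∂volume ∂μ := by
          gcongr with ω y
          exact hφle _
      _ ≤ ∫⁻ ω, ∫⁻ y, (∫⁻ ω', φ (y - U ω') ∂μ) *
            (ENNReal.ofReal (rexp (g y)) * s.indicator 1 (A ω, y)) ∂volume ∂μ := by
          refine lintegral_mono fun ω => lintegral_mono fun y => ?_
          rw [← mul_assoc, mul_comm (∫⁻ ω', φ (y - U ω') ∂μ)]
          exact mul_le_mul_left (hdens y) _
      _ = ∫⁻ ω, ∫⁻ ω', ENNReal.ofReal (rexp (g (Y ω'))) * s.indicator 1 (A ω, Y ω') ∂μ ∂μ := by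
          refine lintegral_congr fun ω => ?_
          have hm : Measurable fun p : S × (ι → ℂ) =>
              ENNReal.ofReal (rexp (g p.2)) * s.indicator 1 (A ω, p.2) := by fun_prop
          rw [hlint hm, lintegral_lintegral_swap (Measurable.aemeasurable (by fun_prop))]
          refine lintegral_congr fun y => ?_
          exact (lintegral_mul_const _ (by fun_prop)).symm
      _ = ∫⁻ p, ENNReal.ofReal (rexp (g p.2)) * s.indicator 1 p ∂((μ.map A).prod (μ.map Y)) := by
          rw [lintegral_prod _ hgi.aemeasurable, lintegral_map hgi.lintegral_prod_right' hA]
          refine lintegral_congr fun ω => ?_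
          rw [lintegral_map (by fun_prop) hY]
      _ = _ := by
          rw [withDensity_apply _ hs, ← lintegral_indicator hs]
          refine lintegral_congr fun p => ?_
          by_cases hp : p ∈ s <;> simp [hp]
  refine (klDiv_le_lintegral_add_one (hgm.comp measurable_snd) (fun p => hg0 p.2) hdom).trans ?_
  rw [lintegral_map (by fun_prop) (hA.prodMk hY)]
  rfl

end AdditiveNoise

/-! ### Block mutual information grows at most linearly -/

section BlockMutualInformation

variable {Ω : Type*} [MeasurableSpace Ω] {μ : Measure Ω} {β P σ2 : ℝ} {L : ℕ}
  {X N : ℕ → Ω → ℂ} {Θ W : ℕ → Ω → ℝ}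

lemma IsInput.lintegral_norm_sq_le [IsProbabilityMeasure μ] (h : IsInput μ P X) (hP : 0 < P)
    (k : ℕ) : ∫⁻ ω, ENNReal.ofReal (‖X k ω‖ ^ 2) ∂μ ≤ ENNReal.ofReal (5 * P / 2) := by
  calc ∫⁻ ω, ENNReal.ofReal (‖X k ω‖ ^ 2) ∂μ
      ≤ ∫⁻ ω, (ENNReal.ofReal (P / 2) + ENNReal.ofReal (‖X k ω‖ ^ 2 - P / 2)) ∂μ := by
        refine lintegral_mono fun ω => ?_
        refine le_trans (ENNReal.ofReal_le_ofReal (le_of_eq ?_)) ENNReal.ofReal_add_le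
        ring
    _ = ENNReal.ofReal (P / 2) + ∫⁻ x, ENNReal.ofReal x ∂expMeasure (2 / P) := by
        rw [lintegral_add_left measurable_const, ← (h.law_abs k).lintegral_comp (by fun_prop)]
        simp
    _ ≤ ENNReal.ofReal (P / 2) + ENNReal.ofReal (4 / (2 / P)) := by
        gcongr
        exact lintegral_expMeasure_le (by positivity)
    _ = ENNReal.ofReal (5 * P / 2) := by
        rw [← ENNReal.ofReal_add (by positivity) (by positivity)]
        congr 1
        field_simp
        norm_num

lemma IsInput.ae_le_norm_sq (h : IsInput μ P X) (k : ℕ) : ∀ᵐ ω ∂μ, P / 2 ≤ ‖X k ω‖ ^ 2 := by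
  have h0 := ((h.law_abs k).ae_iff (p := fun x => 0 ≤ x) (by fun_prop)).2 (expMeasure_ae_nonneg _)
  filter_upwards [h0] with ω hω
  linarith

lemma norm_signal (x : ℂ) (L : ℕ) (θ : ℝ) :
    ‖x * (1 / (L : ℂ)) * Complex.exp (Complex.I * θ)‖ ^ 2 = ‖x‖ ^ 2 * (1 / (L : ℝ)) ^ 2 := by
  rw [norm_mul, Complex.norm_exp_I_mul_ofReal, mul_one, norm_mul, mul_pow]
  simp

/-- The mutual information of input and output blocks grows at most linearly in the block
length; in particular it is finite. -/
lemma IsModel.exists_mutualInfo_le [IsProbabilityMeasure μ] (h : IsModel μ β P σ2 L X N Θ W)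
    (hP : 0 < P) (hσ : 0 < σ2) (hL : 0 < L) :
    ∃ C : ℝ, ∀ n : ℕ, mutualInfo μ (inputBlock X n) (outputBlock L X N Θ n) ≤
      ENNReal.ofReal (C * (n + 1)) := by
  set v : ℝ := σ2 * (1 / (L : ℝ)) with hv
  have hv0 : 0 < v := by positivity
  set c₀ : ℝ := 5 * P / (2 * L) with hc₀
  refine ⟨8 * c₀ / v + 4 * L + 2, fun n => ?_⟩
  -- The energy of the signal is `n * c₀` at most; the extra `c₀` keeps `c` positive at `n = 0`.
  set c : ℝ := (n + 1) * c₀ with hc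
  have hc0 : 0 < c := by positivity
  have mX := h.input.measurable
  have mN := h.noise.measurable
  have mΘ := h.phase.measurable
  set U : Ω → Fin n × Fin L → ℂ := fun ω p =>
    X p.1 ω * (1 / (L : ℂ)) * Complex.exp (Complex.I * Θ (p.1 * L + p.2) ω) with hU
  set Z : Ω → Fin n × Fin L → ℂ := fun ω p => N (p.1 * L + p.2) ω with hZ
  have hUm : Measurable U := measurable_pi_lambda _ fun p => by fun_prop
  have hZm : Measurable Z := measurable_pi_lambda _ fun p => by fun_prop
  have hinj : Function.Injective fun p : Fin n × Fin L => (p.1 : ℕ) * L + p.2 := by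
    rintro ⟨a, b⟩ ⟨a', b'⟩ hab
    simp only at hab
    have h1 : (b : ℕ) = b' := by
      have := congrArg (· % L) hab
      simpa [Nat.mod_eq_of_lt b.2, Nat.mod_eq_of_lt b'.2] using this
    have h2 : (a : ℕ) = a' := by
      rw [h1] at hab
      exact Nat.eq_of_mul_eq_mul_right hL (Nat.add_right_cancel hab)
    exact Prod.ext (Fin.ext h2) (Fin.ext h1)
  have hlaw : μ.map Z = Measure.pi fun _ => complexGaussian v :=
    ((h.noise.iIndep.precomp hinj).hasLaw_pi fun p => h.noise.law _).map_eq
  have hind : IndepFun (fun ω => (inputBlock X n ω, U ω)) Z μ :=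
    h.indepFun_signal_noise.comp
      (φ := fun q : (ℕ → ℂ) × (ℕ → ℝ) => (fun j : Fin n => q.1 j, fun p : Fin n × Fin L =>
        q.1 p.1 * (1 / (L : ℂ)) * Complex.exp (Complex.I * q.2 (p.1 * L + p.2))))
      (ψ := fun (z : ℕ → ℂ) (p : Fin n × Fin L) => z (p.1 * L + p.2))
      (Measurable.prodMk (by fun_prop) (measurable_pi_lambda _ fun p => by fun_prop))
      (measurable_pi_lambda _ fun p => by fun_prop)
  have hUe : ∫⁻ ω, ENNReal.ofReal (∑ p, ‖U ω p‖ ^ 2) ∂μ ≤ ENNReal.ofReal c := by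
    have hle : ∀ p : Fin n × Fin L, ∫⁻ ω, ENNReal.ofReal (‖U ω p‖ ^ 2) ∂μ ≤
        ENNReal.ofReal (5 * P / 2 * (1 / (L : ℝ)) ^ 2) := by
      intro p
      calc ∫⁻ ω, ENNReal.ofReal (‖U ω p‖ ^ 2) ∂μ
          = ∫⁻ ω, ENNReal.ofReal (‖X p.1 ω‖ ^ 2) * ENNReal.ofReal ((1 / (L : ℝ)) ^ 2) ∂μ := by
            refine lintegral_congr fun ω => ?_
            rw [hU, norm_signal, ENNReal.ofReal_mul (by positivity)]
        _ ≤ ENNReal.ofReal (5 * P / 2) * ENNReal.ofReal ((1 / (L : ℝ)) ^ 2) := by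
            rw [lintegral_mul_const _ (by fun_prop)]
            gcongr
            exact h.input.lintegral_norm_sq_le hP _
        _ = _ := by rw [ENNReal.ofReal_mul (by positivity)]
    calc ∫⁻ ω, ENNReal.ofReal (∑ p, ‖U ω p‖ ^ 2) ∂μ
        = ∑ p, ∫⁻ ω, ENNReal.ofReal (‖U ω p‖ ^ 2) ∂μ := by
          rw [← lintegral_finsetSum _ (fun p _ => by fun_prop)]
          simp only [ENNReal.ofReal_sum_of_nonneg (fun p _ => sq_nonneg _)]
      _ ≤ ∑ _p : Fin n × Fin L, ENNReal.ofReal (5 * P / 2 * (1 / (L : ℝ)) ^ 2) :=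
          Finset.sum_le_sum fun p _ => hle p
      _ = ENNReal.ofReal (n * c₀) := by
          rw [← ENNReal.ofReal_sum_of_nonneg (fun p _ => by positivity), Finset.sum_const,
            Finset.card_univ, Fintype.card_prod, Fintype.card_fin, Fintype.card_fin,
            nsmul_eq_mul, hc₀]
          congr 1
          push_cast
          field_simp
      _ ≤ ENNReal.ofReal c := ENNReal.ofReal_le_ofReal (by rw [hc]; gcongr; linarith)
  have hZe : ∫⁻ ω, ENNReal.ofReal (∑ p, ‖Z ω p‖ ^ 2) ∂μ = ENNReal.ofReal (n * L * v) := by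
    calc ∫⁻ ω, ENNReal.ofReal (∑ p, ‖Z ω p‖ ^ 2) ∂μ
        = ∑ p, ∫⁻ ω, ENNReal.ofReal (‖Z ω p‖ ^ 2) ∂μ := by
          rw [← lintegral_finsetSum _ (fun p _ => by fun_prop)]
          simp only [ENNReal.ofReal_sum_of_nonneg (fun p _ => sq_nonneg _)]
      _ = ∑ _p : Fin n × Fin L, ENNReal.ofReal v := by
          refine Finset.sum_congr rfl fun p _ => ?_
          rw [← lintegral_norm_sq_complexGaussian hv0]
          exact (h.noise.law _).lintegral_comp (f := fun z => ENNReal.ofReal (‖z‖ ^ 2))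
            (by fun_prop)
      _ = ENNReal.ofReal (n * L * v) := by
          rw [← ENNReal.ofReal_sum_of_nonneg (fun p _ => hv0.le), Finset.sum_const,
            Finset.card_univ, Fintype.card_prod, Fintype.card_fin, Fintype.card_fin,
            nsmul_eq_mul]
          push_cast
          rfl
  have hYe : ∫⁻ ω, ENNReal.ofReal ((2 * ∑ p, ‖U ω p + Z ω p‖ ^ 2 + 4 * c) / v + Real.log 2) ∂μ ≤
      ENNReal.ofReal (4 / v * c + 4 / v * (n * L * v) + (4 * c / v + Real.log 2)) := by
    calc ∫⁻ ω, ENNReal.ofReal ((2 * ∑ p, ‖U ω p + Z ω p‖ ^ 2 + 4 * c) / v + Real.log 2) ∂μ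
        ≤ ∫⁻ ω, (ENNReal.ofReal (4 / v) * ENNReal.ofReal (∑ p, ‖U ω p‖ ^ 2) +
            ENNReal.ofReal (4 / v) * ENNReal.ofReal (∑ p, ‖Z ω p‖ ^ 2) +
            ENNReal.ofReal (4 * c / v + Real.log 2)) ∂μ := by
          refine lintegral_mono fun ω => ?_
          rw [← ENNReal.ofReal_mul (by positivity), ← ENNReal.ofReal_mul (by positivity),
            ← ENNReal.ofReal_add (by positivity) (by positivity),
            ← ENNReal.ofReal_add (by positivity) (by positivity)]
          refine ENNReal.ofReal_le_ofReal ?_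
          have hpar : ∑ p, ‖U ω p + Z ω p‖ ^ 2 ≤
              2 * ∑ p, ‖U ω p‖ ^ 2 + 2 * ∑ p, ‖Z ω p‖ ^ 2 := by
            rw [Finset.mul_sum, Finset.mul_sum, ← Finset.sum_add_distrib]
            refine Finset.sum_le_sum fun p _ => ?_
            have h := norm_add_le (U ω p) (Z ω p)
            nlinarith [norm_nonneg (U ω p + Z ω p), sq_nonneg (‖U ω p‖ - ‖Z ω p‖)]
          calc (2 * ∑ p, ‖U ω p + Z ω p‖ ^ 2 + 4 * c) / v + Real.log 2
              ≤ (2 * (2 * ∑ p, ‖U ω p‖ ^ 2 + 2 * ∑ p, ‖Z ω p‖ ^ 2) + 4 * c) / v + Real.log 2 := by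
                gcongr
            _ = _ := by ring
      _ ≤ _ := by
          rw [lintegral_add_right _ measurable_const, lintegral_add_left (by fun_prop),
            lintegral_const_mul _ (by fun_prop), lintegral_const_mul _ (by fun_prop), hZe,
            lintegral_const, measure_univ, mul_one,
            ENNReal.ofReal_add (p := 4 / v * c + 4 / v * (n * L * v)) (by positivity)
              (by positivity),
            ENNReal.ofReal_add (p := 4 / v * c) (by positivity) (by positivity),
            ENNReal.ofReal_mul (p := 4 / v) (q := c) (by positivity),
            ENNReal.ofReal_mul (p := 4 / v) (q := n * L * v) (by positivity)]
          gcongr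
  have hdpi := mutualInfo_comp_le (μ := μ) (f := id) (h.measurable_inputBlock n)
    (B := fun ω p => U ω p + Z ω p) (measurable_pi_lambda _ fun p => by fun_prop) measurable_id
    (g := fun (y : Fin n × Fin L → ℂ) (j : Fin n) (l : Fin L) => y (j, l)) (by fun_prop)
  have hout : (fun ω (j : Fin n) (l : Fin L) => U ω (j, l) + Z ω (j, l)) =
      outputBlock L X N Θ n := by
    ext ω j l
    rw [outputBlock, output_mul_add]
  rw [hout] at hdpi
  refine hdpi.trans ((mutualInfo_add_noise_le hv0 hc0 (h.measurable_inputBlock n) hUm hZm hind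
    hlaw hUe).trans ((add_le_add_left hYe 1).trans ?_))
  have hlog : Real.log 2 ≤ 1 := by
    have := Real.log_two_lt_d9
    linarith
  rw [← ENNReal.ofReal_one, ← ENNReal.ofReal_add (by positivity) zero_le_one]
  refine ENNReal.ofReal_le_ofReal ?_
  have e1 : 4 / v * (n * L * v) = 4 * L * n := by field_simp
  have e2 : 4 / v * c = 4 * c₀ / v * (n + 1) := by rw [hc]; ring
  have e3 : 4 * c / v = 4 * c₀ / v * (n + 1) := by rw [hc]; ring
  rw [e1, e2, e3]
  calc 4 * c₀ / v * (n + 1) + 4 * L * n + (4 * c₀ / v * (n + 1) + Real.log 2) + 1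
      ≤ 4 * c₀ / v * (n + 1) + 4 * L * (n + 1) + (4 * c₀ / v * (n + 1) + 1) + (1 + 2 * n) := by
        gcongr <;> linarith
    _ = (8 * c₀ / v + 4 * L + 2) * (n + 1) := by ring

end BlockMutualInformation

/-! ### The decoding metric and its mean under independence -/

section Metric

open Real

variable {Ω : Type*} [MeasurableSpace Ω] {μ : Measure Ω} {P : ℝ} {L : ℕ} {X : ℕ → Ω → ℂ}

/-- The squared mismatch between the symbol `x` and an estimate `a` of `|x|²`, on the scale `s`,
plus the squared mismatch between the received sample `w` and the signal predicted from `x` with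
the unit phasor `b`, on the scale `v`. -/
noncomputable def metric (L : ℕ) (s v a : ℝ) (b w x : ℂ) : ℝ :=
  (a - ‖x‖ ^ 2) ^ 2 / (2 * s) + ‖w - x * (1 / (L : ℂ)) * b‖ ^ 2 / (2 * v)

@[fun_prop]
lemma measurable_metric {α : Type*} [MeasurableSpace α] (L : ℕ) (s v : ℝ) {a : α → ℝ}
    {b w x : α → ℂ} (ha : Measurable a) (hb : Measurable b) (hw : Measurable w)
    (hx : Measurable x) : Measurable fun t => metric L s v (a t) (b t) (w t) (x t) := by
  unfold metric
  fun_prop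

lemma metric_nonneg {s v : ℝ} (hs : 0 ≤ s) (hv : 0 ≤ v) (a : ℝ) (b w x : ℂ) :
    0 ≤ metric L s v a b w x := by
  unfold metric
  positivity

/-- A random symbol is unlikely to match a given observation: the Gaussian windows of the metric
catch a small part of the exponential law of the energy and of the uniform law of the phase. The
amplitude is bounded away from zero, so the phase window is narrow for every amplitude. -/
lemma IsInput.lintegral_exp_neg_metric_le [IsProbabilityMeasure μ] (h : IsInput μ P X) (hP : 0 < P)
    (hL : 0 < L) {s v : ℝ} (hs : 0 < s) (hv : 0 < v) (a : ℝ) {b : ℂ} (hb : ‖b‖ = 1) (w : ℂ)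
    (k : ℕ) : ∫⁻ ω, ENNReal.ofReal (rexp (-metric L s v a b w (X k ω))) ∂μ ≤
      ENNReal.ofReal (2 / P * √(2 * π * s) * (2 * √v / (√(P / 2) * (1 / L)))) := by
  have hX := h.measurable k
  have hρ : Measurable fun ω => ‖X k ω‖ := hX.norm
  have hφ : Measurable fun ω => (X k ω).arg := by fun_prop
  have hjoint := (indepFun_iff_map_prod_eq_prod_map_map hρ.aemeasurable hφ.aemeasurable).1
    (h.indep_abs_arg k)
  rw [(h.law_arg k).map_eq] at hjoint
  set F : ℝ × ℝ → ℝ≥0∞ := fun p => ENNReal.ofReal (rexp (-(a - p.1 ^ 2) ^ 2 / (2 * s))) *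
    ENNReal.ofReal (rexp (-‖w - ((p.1 * (1 / L) : ℝ) : ℂ) *
      Complex.exp (Complex.I * ((p.2 + b.arg : ℝ) : ℂ))‖ ^ 2 / (2 * v))) with hF
  have hFm : Measurable F := by fun_prop
  calc ∫⁻ ω, ENNReal.ofReal (rexp (-metric L s v a b w (X k ω))) ∂μ
      = ∫⁻ ω, F (‖X k ω‖, (X k ω).arg) ∂μ := by
        refine lintegral_congr fun ω => ?_
        have hpolar : X k ω * (1 / (L : ℂ)) * b = ((‖X k ω‖ * (1 / L) : ℝ) : ℂ) *
            Complex.exp (Complex.I * (((X k ω).arg + b.arg : ℝ) : ℂ)) := by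
          have h1 := Complex.norm_mul_exp_arg_mul_I (X k ω)
          have h2 := Complex.norm_mul_exp_arg_mul_I b
          rw [hb, Complex.ofReal_one, one_mul] at h2
          nth_rewrite 1 [← h1]
          nth_rewrite 1 [← h2]
          push_cast
          rw [mul_add, Complex.exp_add, mul_comm Complex.I, mul_comm Complex.I]
          ring
        rw [hF]
        simp only
        rw [← hpolar, ← ENNReal.ofReal_mul (exp_pos _).le, ← exp_add, metric]
        congr 2
        ring
    _ = ∫⁻ ω, ∫⁻ φ, F (‖X k ω‖, φ) ∂uniformAngle ∂μ := by
        rw [← lintegral_map hFm.lintegral_prod_right' hρ, ← lintegral_prod _ hFm.aemeasurable,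
          ← hjoint, lintegral_map hFm (hρ.prodMk hφ)]
    _ ≤ ∫⁻ ω, ENNReal.ofReal (rexp (-(a - ‖X k ω‖ ^ 2) ^ 2 / (2 * s))) *
          ENNReal.ofReal (2 * √v / (√(P / 2) * (1 / L))) ∂μ := by
        refine lintegral_mono_ae ?_
        filter_upwards [h.ae_le_norm_sq k] with ω hω
        have hle : √(P / 2) ≤ ‖X k ω‖ := sqrt_le_iff.2 ⟨norm_nonneg _, hω⟩
        have hpos : 0 < √(P / 2) := sqrt_pos.2 (by positivity)
        have hu : 0 < ‖X k ω‖ * (1 / (L : ℝ)) := mul_pos (hpos.trans_le hle) (by positivity)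
        simp only [hF]
        rw [lintegral_const_mul _ (by fun_prop)]
        gcongr
        refine (lintegral_uniformAngle_add (periodic_comp_exp_I fun z => ENNReal.ofReal (rexp (-‖w -
          ((‖X k ω‖ * (1 / L) : ℝ) : ℂ) * z‖ ^ 2 / (2 * v)))) b.arg).trans_le ?_
        refine (lintegral_uniformAngle_exp_le hu hv w).trans (ENNReal.ofReal_le_ofReal ?_)
        gcongr
    _ = (∫⁻ x, ENNReal.ofReal (rexp (-(a - P / 2 - x) ^ 2 / (2 * s))) ∂expMeasure (2 / P)) *
          ENNReal.ofReal (2 * √v / (√(P / 2) * (1 / L))) := by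
        rw [lintegral_mul_const _ (by fun_prop),
          ← (h.law_abs k).lintegral_comp (Measurable.aemeasurable (by fun_prop))]
        simp only [sub_sub, add_sub_cancel]
    _ ≤ ENNReal.ofReal (2 / P * √(2 * π * s)) *
          ENNReal.ofReal (2 * √v / (√(P / 2) * (1 / L))) := by
        gcongr
        exact lintegral_expMeasure_exp_le (by positivity) hs _
    _ = _ := (ENNReal.ofReal_mul (by positivity)).symm

lemma measurable_comp₂ {α : Type*} [MeasurableSpace α] {g : ℂ → ℂ → ℝ≥0∞}
    (hg : Measurable fun p : ℂ × ℂ => g p.1 p.2) {p q : α → ℂ} (hp : Measurable p)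
    (hq : Measurable q) : Measurable fun t => g (p t) (q t) :=
  hg.comp (hp.prodMk hq)

/-- Independent symbols can be integrated out one at a time, the last one first, so the mean of a
product of functions of consecutive symbols is bounded factor by factor. -/
lemma lintegral_prod_consecutive_le [IsProbabilityMeasure μ] (hX : ∀ k, Measurable (X k))
    (hind : iIndepFun X μ) {κ : ℝ≥0∞} (m : ℕ) (g : Fin m → ℂ → ℂ → ℝ≥0∞)
    (hg : ∀ k, Measurable fun p : ℂ × ℂ => g k p.1 p.2)
    (hκ : ∀ k x, ∫⁻ ω, g k x (X (k + 1) ω) ∂μ ≤ κ) :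
    ∫⁻ ω, ∏ k, g k (X k ω) (X (k + 1) ω) ∂μ ≤ κ ^ m := by
  induction m with
  | zero => simp
  | succ m ih =>
    have hprev := ih (fun k => g k.castSucc) (fun k => hg _) (fun k x => hκ k.castSucc x)
    simp only [Fin.prod_univ_castSucc, Fin.val_castSucc, Fin.val_last]
    have hindep : IndepFun (fun ω (i : Finset.range (m + 1)) => X i ω) (X (m + 1)) μ :=
      (hind.indepFun_finset (Finset.range (m + 1)) {m + 1} (by simp) hX).comp
        (φ := id) (ψ := fun x : (i : ({m + 1} : Finset ℕ)) → ℂ => x ⟨m + 1, by simp⟩)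
        measurable_id (by fun_prop)
    have hV : Measurable fun ω (i : Finset.range (m + 1)) => X i ω :=
      measurable_pi_lambda _ fun i => hX i
    have hjoint := (indepFun_iff_map_prod_eq_prod_map_map hV.aemeasurable
      (hX (m + 1)).aemeasurable).1 hindep
    have := Measure.isProbabilityMeasure_map (μ := μ) hV.aemeasurable
    have := Measure.isProbabilityMeasure_map (μ := μ) (hX (m + 1)).aemeasurable
    set Φ : ((i : Finset.range (m + 1)) → ℂ) × ℂ → ℝ≥0∞ := fun p =>
      (∏ k : Fin m, g k.castSucc (p.1 ⟨k, by simp⟩) (p.1 ⟨k + 1, by simp⟩)) *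
        g (Fin.last m) (p.1 ⟨m, by simp⟩) p.2 with hΦ
    have hΦm : Measurable Φ := by
      refine Measurable.mul ?_ (measurable_comp₂ (hg _) (by fun_prop) (by fun_prop))
      exact Finset.measurable_fun_prod _ fun k _ =>
        measurable_comp₂ (hg _) (by fun_prop) (by fun_prop)
    calc ∫⁻ ω, (∏ k : Fin m, g k.castSucc (X k ω) (X (k + 1) ω)) *
          g (Fin.last m) (X m ω) (X (m + 1) ω) ∂μ
        = ∫⁻ ω, ∫⁻ ω', Φ (fun i => X i ω, X (m + 1) ω') ∂μ ∂μ := by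
          have h1 : ∫⁻ ω, Φ (fun i => X i ω, X (m + 1) ω) ∂μ =
              ∫⁻ ω, ∫⁻ ω', Φ (fun i => X i ω, X (m + 1) ω') ∂μ ∂μ := by
            rw [← lintegral_map hΦm (hV.prodMk (hX (m + 1))), hjoint,
              lintegral_prod _ hΦm.aemeasurable, lintegral_map hΦm.lintegral_prod_right' hV]
            refine lintegral_congr fun ω => ?_
            exact lintegral_map (hΦm.comp measurable_prodMk_left) (hX (m + 1))
          exact h1
      _ ≤ ∫⁻ ω, (∏ k : Fin m, g k.castSucc (X k ω) (X (k + 1) ω)) * κ ∂μ := by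
          refine lintegral_mono fun ω => ?_
          simp only [hΦ]
          refine (lintegral_const_mul _
            (measurable_comp₂ (hg _) measurable_const (hX _))).trans_le ?_
          gcongr
          exact hκ (Fin.last m) _
      _ ≤ κ ^ m * κ := by
          rw [lintegral_mul_const]
          · gcongr
          · exact Finset.measurable_fun_prod _ fun k _ => measurable_comp₂ (hg _) (hX _) (hX _)
      _ = κ ^ (m + 1) := (pow_succ κ m).symm

end Metric

/-! ### The mean of the decoding metric over the channel -/

section Channel

open Real

variable {Ω : Type*} [MeasurableSpace Ω] {μ : Measure Ω} [IsProbabilityMeasure μ]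
  {β P σ2 : ℝ} {L : ℕ} {X N : ℕ → Ω → ℂ} {Θ W : ℕ → Ω → ℝ}

/-- The unbiased estimate of the energy `|x|²` of a symbol from its `L` output samples. -/
noncomputable def energyEstimate (σ2 : ℝ) {L : ℕ} (y : Fin L → ℂ) : ℝ :=
  L * ∑ l, ‖y l‖ ^ 2 - σ2 * L

@[fun_prop]
lemma measurable_energyEstimate (σ2 : ℝ) : Measurable (energyEstimate σ2 : (Fin L → ℂ) → ℝ) := by
  unfold energyEstimate
  fun_prop

/-- Given the signal `u`, the received energy is a sum of independent terms. -/
lemma IsAdditiveNoise.lintegral_energy_sub_sq_le (h : IsAdditiveNoise μ σ2 L N) (hσ : 0 < σ2)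
    (hL : 0 < L) (k : ℕ) (x : ℂ) (u : Fin L → ℂ)
    (hu : ∀ l, ‖u l‖ ^ 2 = ‖x‖ ^ 2 * (1 / (L : ℝ)) ^ 2) :
    ∫⁻ ω, ENNReal.ofReal ((energyEstimate σ2 (fun l => u l + N (k * L + l) ω) - ‖x‖ ^ 2) ^ 2) ∂μ ≤
      ENNReal.ofReal (8 * σ2 * ‖x‖ ^ 2 + 194 * L * σ2 ^ 2) := by
  set v : ℝ := σ2 * (1 / (L : ℝ)) with hv
  have hv0 : 0 < v := by positivity
  set T : Fin L → Ω → ℝ := fun l ω => ‖u l + N (k * L + l) ω‖ ^ 2 with hT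
  have hlaw : ∀ l : Fin L, HasLaw (N (k * L + l)) (complexGaussian v) μ := fun l => h.law _
  have hNm := h.measurable
  have hmem : ∀ l, MemLp (T l) 2 μ := fun l => by
    have := memLp_norm_add_sq_complexGaussian (v := v) (u l)
    rw [← (hlaw l).map_eq] at this
    exact this.comp_of_map (hNm _).aemeasurable
  have hmean : ∀ l, ∫ ω, T l ω ∂μ = ‖u l‖ ^ 2 + v := fun l => by
    rw [← integral_norm_add_sq_complexGaussian hv0]
    exact (hlaw l).integral_comp (f := fun z => ‖u l + z‖ ^ 2) (by fun_prop)
  have hvar : ∀ l, Var[T l; μ] ≤ 8 * ‖u l‖ ^ 2 * v + 194 * v ^ 2 := fun l => by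
    refine le_of_eq_of_le ?_ (variance_norm_add_sq_complexGaussian_le hv0 (u l))
    have hm : AEMeasurable (fun z : ℂ => ‖u l + z‖ ^ 2) (μ.map (N (k * L + l))) := by fun_prop
    rw [← (hlaw l).map_eq, variance_map hm (hNm _).aemeasurable]
    rfl
  have hinj : Function.Injective fun l : Fin L => k * L + (l : ℕ) := fun a b hab =>
    Fin.ext (Nat.add_left_cancel hab)
  have hind : iIndepFun T μ := (h.iIndep.precomp hinj).comp (fun l z => ‖u l + z‖ ^ 2)
    (fun l => by fun_prop)
  have hsum : Var[∑ l, T l; μ] = ∑ l, Var[T l; μ] :=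
    IndepFun.variance_sum (fun l _ => hmem l) fun i _ j _ hij => hind.indepFun hij
  have hsumm : MemLp (∑ l, T l) 2 μ := memLp_finsetSum' _ fun l _ => hmem l
  have hsmean : ∫ ω, (∑ l, T l) ω ∂μ = ‖x‖ ^ 2 * (1 / (L : ℝ)) + σ2 := by
    simp only [Finset.sum_apply]
    rw [integral_finsetSum _ fun l _ => (hmem l).integrable one_le_two]
    simp only [hmean, hu, Finset.sum_const, Finset.card_univ, Fintype.card_fin, nsmul_eq_mul, hv]
    field_simp
  have hvle : Var[∑ l, T l; μ] ≤ L * (8 * (‖x‖ ^ 2 * (1 / (L : ℝ)) ^ 2) * v + 194 * v ^ 2) := by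
    rw [hsum]
    refine (Finset.sum_le_sum fun l _ => hvar l).trans (le_of_eq ?_)
    simp only [hu, Finset.sum_const, Finset.card_univ, Fintype.card_fin, nsmul_eq_mul]
  have hint : Integrable (fun ω => ((∑ l, T l) ω - ∫ ω, (∑ l, T l) ω ∂μ) ^ 2) μ :=
    (hsumm.sub (memLp_const _)).integrable_sq
  calc ∫⁻ ω, ENNReal.ofReal ((energyEstimate σ2 (fun l => u l + N (k * L + l) ω) - ‖x‖ ^ 2) ^ 2) ∂μ
      = ∫⁻ ω, ENNReal.ofReal ((L : ℝ) ^ 2) *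
          ENNReal.ofReal (((∑ l, T l) ω - ∫ ω, (∑ l, T l) ω ∂μ) ^ 2) ∂μ := by
        refine lintegral_congr fun ω => ?_
        rw [← ENNReal.ofReal_mul (by positivity), hsmean, energyEstimate, ← mul_pow,
          Finset.sum_apply]
        congr 2
        field_simp
        ring
    _ = ENNReal.ofReal ((L : ℝ) ^ 2) * ENNReal.ofReal Var[∑ l, T l; μ] := by
        rw [lintegral_const_mul' _ _ ENNReal.ofReal_ne_top,
          ← ofReal_integral_eq_lintegral_ofReal hint (ae_of_all _ fun _ => sq_nonneg _),
          variance_eq_integral hsumm.aestronglyMeasurable.aemeasurable]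
    _ ≤ ENNReal.ofReal (8 * σ2 * ‖x‖ ^ 2 + 194 * L * σ2 ^ 2) := by
        rw [← ENNReal.ofReal_mul (by positivity)]
        refine ENNReal.ofReal_le_ofReal ?_
        calc (L : ℝ) ^ 2 * Var[∑ l, T l; μ]
            ≤ (L : ℝ) ^ 2 * (L * (8 * (‖x‖ ^ 2 * (1 / (L : ℝ)) ^ 2) * v + 194 * v ^ 2)) := by
              gcongr
          _ = 8 * σ2 * ‖x‖ ^ 2 + 194 * L * σ2 ^ 2 := by
              rw [hv]
              field_simp

lemma IsModel.lintegral_energy_sub_sq_le (h : IsModel μ β P σ2 L X N Θ W) (hP : 0 < P)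
    (hσ : 0 < σ2) (hL : 0 < L) (n : ℕ) (k : Fin n) :
    ∫⁻ ω, ENNReal.ofReal ((energyEstimate σ2 (outputBlock L X N Θ n ω k) - ‖X k ω‖ ^ 2) ^ 2) ∂μ ≤
      ENNReal.ofReal (20 * P * σ2 + 194 * L * σ2 ^ 2) := by
  have hN := h.measurable_N
  have hX := h.measurable_X
  have hΘ := h.measurable_Θ
  have := Measure.isProbabilityMeasure_map (μ := μ) hΘ.aemeasurable
  set F : (ℕ → ℂ) → (ℕ → ℝ) → (ℕ → ℂ) → ℝ≥0∞ := fun x θ z => ENNReal.ofReal ((energyEstimate σ2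
    (fun l : Fin L => x k * (1 / (L : ℂ)) * Complex.exp (Complex.I * θ (k * L + l)) + z (k * L + l))
      - ‖x k‖ ^ 2) ^ 2) with hF
  have hFm : Measurable fun p : (ℕ → ℂ) × (ℕ → ℝ) × (ℕ → ℂ) => F p.1 p.2.1 p.2.2 := by
    refine ENNReal.measurable_ofReal.comp (Measurable.pow_const (Measurable.sub ?_ (by fun_prop)) _)
    exact (measurable_energyEstimate σ2).comp (measurable_pi_lambda _ fun l => by fun_prop)
  calc ∫⁻ ω, ENNReal.ofReal ((energyEstimate σ2 (outputBlock L X N Θ n ω k) - ‖X k ω‖ ^ 2) ^ 2) ∂μ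
      = ∫⁻ ω, F (fun k => X k ω) (fun k => Θ k ω) (fun k => N k ω) ∂μ := by
        refine lintegral_congr fun ω => ?_
        have : outputBlock L X N Θ n ω k = fun l : Fin L => X k ω * (1 / (L : ℂ)) *
            Complex.exp (Complex.I * Θ (k * L + l) ω) + N (k * L + l) ω := by
          ext l
          rw [outputBlock, output_mul_add]
        rw [this]
    _ = ∫⁻ x, ∫⁻ θ, ∫⁻ z, F x θ z ∂(μ.map fun ω k => N k ω) ∂(μ.map fun ω k => Θ k ω)
          ∂(μ.map fun ω k => X k ω) := h.lintegral_eq hFm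
    _ ≤ ∫⁻ x, ∫⁻ _θ, ENNReal.ofReal (8 * σ2 * ‖x k‖ ^ 2 + 194 * L * σ2 ^ 2)
          ∂(μ.map fun ω k => Θ k ω) ∂(μ.map fun ω k => X k ω) := by
        refine lintegral_mono fun x => lintegral_mono fun θ => ?_
        have hm : Measurable (F x θ) := hFm.comp
          (g := fun p : (ℕ → ℂ) × (ℕ → ℝ) × (ℕ → ℂ) => F p.1 p.2.1 p.2.2)
          (f := fun z : ℕ → ℂ => (x, θ, z)) (by fun_prop)
        rw [lintegral_map hm hN]
        exact h.noise.lintegral_energy_sub_sq_le hσ hL k (x k) _ fun l => norm_signal _ _ _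
    _ = ∫⁻ ω, ENNReal.ofReal (8 * σ2 * ‖X k ω‖ ^ 2 + 194 * L * σ2 ^ 2) ∂μ := by
        simp only [lintegral_const, measure_univ, mul_one]
        rw [lintegral_map (by fun_prop) hX]
    _ ≤ ENNReal.ofReal (8 * σ2) * ENNReal.ofReal (5 * P / 2) +
          ENNReal.ofReal (194 * L * σ2 ^ 2) := by
        have hXk := h.input.measurable k
        calc ∫⁻ ω, ENNReal.ofReal (8 * σ2 * ‖X k ω‖ ^ 2 + 194 * L * σ2 ^ 2) ∂μ
            = ∫⁻ ω, (ENNReal.ofReal (8 * σ2) * ENNReal.ofReal (‖X k ω‖ ^ 2) +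
                ENNReal.ofReal (194 * L * σ2 ^ 2)) ∂μ := by
              refine lintegral_congr fun ω => ?_
              rw [ENNReal.ofReal_add (by positivity) (by positivity),
                ENNReal.ofReal_mul (by positivity)]
          _ ≤ _ := by
              rw [lintegral_add_right _ measurable_const, lintegral_const_mul _ (by fun_prop)]
              simp only [lintegral_const, measure_univ, mul_one]
              gcongr
              exact h.input.lintegral_norm_sq_le hP k
    _ = _ := by
        rw [← ENNReal.ofReal_mul (by positivity), ← ENNReal.ofReal_add (by positivity)
          (by positivity)]
        congr 1
        ring

/-- Normalizing a complex number to the unit circle at most doubles its distance to a point of the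
circle. -/
lemma norm_exp_arg_sub_le (z u : ℂ) (hu : ‖u‖ = 1) :
    ‖u - Complex.exp (Complex.I * z.arg)‖ ≤ 2 * ‖z - u‖ := by
  have h1 : ‖z - Complex.exp (Complex.I * z.arg)‖ = |‖z‖ - 1| := by
    have hz := Complex.norm_mul_exp_arg_mul_I z
    nth_rewrite 1 [← hz]
    rw [mul_comm Complex.I, ← sub_one_mul, norm_mul, Complex.norm_exp_ofReal_mul_I, mul_one,
      ← Complex.ofReal_one, ← Complex.ofReal_sub, Complex.norm_real, Real.norm_eq_abs]
  have h2 : |‖z‖ - 1| ≤ ‖z - u‖ := by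
    rw [← hu]
    exact abs_norm_sub_norm_le z u
  calc ‖u - Complex.exp (Complex.I * z.arg)‖
      ≤ ‖u - z‖ + ‖z - Complex.exp (Complex.I * z.arg)‖ := norm_sub_le_norm_sub_add_norm_sub _ _ _
    _ ≤ ‖z - u‖ + ‖z - u‖ := by
        rw [h1, norm_sub_rev u z]
        gcongr
    _ = 2 * ‖z - u‖ := by ring

/-- The phase reference `exp (j arg (y / x'))`, computed from the last sample `y` of the previous
symbol `x'`, predicts the signal part of the next sample up to the phase increment `δ` and the
additive noise `z` of the sample used. -/
lemma norm_sample_sub_prediction_sq_le {L : ℕ} (hL : 0 < L) {P : ℝ} (hP : 0 < P) {x' x z z' : ℂ}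
    {θ δ : ℝ} (hx' : P / 2 ≤ ‖x'‖ ^ 2) :
    ‖(x * (1 / (L : ℂ)) * Complex.exp (Complex.I * ((θ + δ : ℝ) : ℂ)) + z') - x * (1 / (L : ℂ)) *
      Complex.exp (Complex.I *
        ((x' * (1 / (L : ℂ)) * Complex.exp (Complex.I * θ) + z) / x').arg)‖ ^ 2 ≤
      ‖x‖ ^ 2 * (4 / (L : ℝ) ^ 2 * δ ^ 2 + 32 / P * ‖z‖ ^ 2) + 2 * ‖z'‖ ^ 2 := by
  have hL' : (0 : ℝ) < L := by exact_mod_cast hL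
  have hLC : (L : ℂ) ≠ 0 := by exact_mod_cast hL.ne'
  have hx'0 : 0 < ‖x'‖ := by
    rcases (norm_nonneg x').eq_or_lt with h | h
    · rw [← h] at hx'
      nlinarith
    · exact h
  have hx'C : x' ≠ 0 := norm_pos_iff.1 hx'0
  set e : ℂ := Complex.exp (Complex.I * θ) with he
  have hen : ‖e‖ = 1 := Complex.norm_exp_I_mul_ofReal θ
  set q : ℂ := (x' * (1 / (L : ℂ)) * e + z) / x' with hq
  set b : ℂ := Complex.exp (Complex.I * q.arg) with hb
  -- The argument of `q` is that of `L q`, which is close to the unit phasor `e`.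
  have hLq : ((L : ℂ) * q).arg = q.arg := by
    have := Complex.arg_real_mul q hL'
    rwa [Complex.ofReal_natCast] at this
  have hqe : (L : ℂ) * q - e = L * z / x' := by
    rw [hq]
    field_simp
    ring
  have h1 : ‖e - b‖ ≤ 2 * (L * ‖z‖ / ‖x'‖) := by
    have h := norm_exp_arg_sub_le ((L : ℂ) * q) e hen
    rw [hLq, hqe, norm_div, norm_mul, Complex.norm_natCast] at h
    exact h
  have h2 : ‖Complex.exp (Complex.I * ((θ + δ : ℝ) : ℂ)) - e‖ ≤ |δ| := by
    have heq : Complex.exp (Complex.I * ((θ + δ : ℝ) : ℂ)) - e =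
        e * (Complex.exp (Complex.I * δ) - 1) := by
      rw [he, mul_sub, ← Complex.exp_add, mul_one]
      congr 2
      push_cast
      ring
    rw [heq, norm_mul, hen, one_mul, ← Real.norm_eq_abs]
    exact Real.norm_exp_I_mul_ofReal_sub_one_le
  set d : ℂ := Complex.exp (Complex.I * ((θ + δ : ℝ) : ℂ)) - b with hd
  have h3 : ‖d‖ ^ 2 ≤ 2 * δ ^ 2 + 16 * L ^ 2 / P * ‖z‖ ^ 2 := by
    have hle : ‖d‖ ≤ |δ| + 2 * (L * ‖z‖ / ‖x'‖) := by
      have : d = (Complex.exp (Complex.I * ((θ + δ : ℝ) : ℂ)) - e) + (e - b) := by rw [hd]; ring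
      rw [this]
      exact (norm_add_le _ _).trans (add_le_add h2 h1)
    have hz : (L * ‖z‖ / ‖x'‖) ^ 2 ≤ 2 * L ^ 2 / P * ‖z‖ ^ 2 := by
      rw [div_pow, div_le_iff₀ (by positivity), mul_pow]
      calc (L : ℝ) ^ 2 * ‖z‖ ^ 2 = 2 * L ^ 2 / P * ‖z‖ ^ 2 * (P / 2) := by field_simp
        _ ≤ 2 * L ^ 2 / P * ‖z‖ ^ 2 * ‖x'‖ ^ 2 := by gcongr
    calc ‖d‖ ^ 2 ≤ (|δ| + 2 * (L * ‖z‖ / ‖x'‖)) ^ 2 := by gcongr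
      _ ≤ 2 * |δ| ^ 2 + 8 * (L * ‖z‖ / ‖x'‖) ^ 2 := by
          nlinarith [sq_nonneg (|δ| - 2 * (L * ‖z‖ / ‖x'‖))]
      _ ≤ 2 * δ ^ 2 + 8 * (2 * L ^ 2 / P * ‖z‖ ^ 2) := by
          rw [sq_abs]
          gcongr
      _ = _ := by ring
  have h4 : (x * (1 / (L : ℂ)) * Complex.exp (Complex.I * ((θ + δ : ℝ) : ℂ)) + z') -
      x * (1 / (L : ℂ)) * b = x * (1 / (L : ℂ)) * d + z' := by rw [hd]; ring
  have h5 : ‖x * (1 / (L : ℂ)) * d‖ ^ 2 = ‖x‖ ^ 2 / (L : ℝ) ^ 2 * ‖d‖ ^ 2 := by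
    rw [norm_mul, norm_mul, norm_div, norm_one, Complex.norm_natCast]
    ring
  rw [h4]
  calc ‖x * (1 / (L : ℂ)) * d + z'‖ ^ 2
      ≤ 2 * ‖x * (1 / (L : ℂ)) * d‖ ^ 2 + 2 * ‖z'‖ ^ 2 := by
        have h := norm_add_le (x * (1 / (L : ℂ)) * d) z'
        nlinarith [norm_nonneg (x * (1 / (L : ℂ)) * d + z'),
          sq_nonneg (‖x * (1 / (L : ℂ)) * d‖ - ‖z'‖)]
    _ ≤ 2 * (‖x‖ ^ 2 / (L : ℝ) ^ 2 * (2 * δ ^ 2 + 16 * L ^ 2 / P * ‖z‖ ^ 2)) + 2 * ‖z'‖ ^ 2 := by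
        rw [h5]
        gcongr
    _ = _ := by
        field_simp
        ring

/-- The sample that follows the last one of symbol `k` is predicted up to the mean square of one
phase increment, `P β / L³` in order of magnitude, and of the additive noise, `σ² / L`. -/
lemma IsModel.lintegral_sample_sub_prediction_sq_le (h : IsModel μ β P σ2 L X N Θ W) (hβ : 0 < β)
    (hP : 0 < P) (hσ : 0 < σ2) (hL : 0 < L) (k : ℕ) :
    ∫⁻ ω, ENNReal.ofReal (‖output L X N Θ ((k + 1) * L) ω - X (k + 1) ω * (1 / (L : ℂ)) *
      Complex.exp (Complex.I * (output L X N Θ (k * L + (L - 1)) ω / X k ω).arg)‖ ^ 2) ∂μ ≤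
      ENNReal.ofReal (20 * π * β * P / L ^ 3 + 82 * σ2 / L) := by
  set v : ℝ := σ2 * (1 / (L : ℝ)) with hv
  have hv0 : 0 < v := by positivity
  set j : ℕ := k * L + (L - 1) with hj
  have hj1 : (k + 1) * L = j + 1 := by
    rw [hj, add_mul, one_mul]
    omega
  have mX := h.input.measurable
  have mN := h.noise.measurable
  have mW := h.phase.measurable_incr
  have hNsq : ∀ i, ∫⁻ ω, ENNReal.ofReal (‖N i ω‖ ^ 2) ∂μ = ENNReal.ofReal v := fun i => by
    rw [← lintegral_norm_sq_complexGaussian hv0]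
    exact (h.noise.law i).lintegral_comp (f := fun z => ENNReal.ofReal (‖z‖ ^ 2)) (by fun_prop)
  have hWsq : ∫⁻ ω, ENNReal.ofReal (W j ω ^ 2) ∂μ = ENNReal.ofReal (2 * π * β * (1 / (L : ℝ))) := by
    have h1 : ∫⁻ ω, ENNReal.ofReal (W j ω ^ 2) ∂μ = ∫⁻ x, ENNReal.ofReal (x ^ 2)
        ∂gaussianReal 0 (2 * π * β * (1 / (L : ℝ))).toNNReal :=
      (h.phase.law_incr j).lintegral_comp (f := fun x => ENNReal.ofReal (x ^ 2)) (by fun_prop)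
    rw [h1, ← ofReal_integral_eq_lintegral_ofReal (integrable_pow_gaussianReal _ 2)
      (ae_of_all _ fun _ => sq_nonneg _), integral_sq_gaussianReal, Real.coe_toNNReal _
      (by positivity)]
  have hindep : IndepFun (X (k + 1)) (fun ω => (N j ω, W j ω)) μ := by
    have hWj : ∀ ω, W j ω = Θ (j + 1) ω - Θ j ω := fun ω => by rw [h.phase.step]; ring
    simp only [hWj]
    exact h.indep_input.comp (φ := fun x : ℕ → ℂ => x (k + 1))
      (ψ := fun q : (ℕ → ℂ) × (ℕ → ℝ) => (q.1 j, q.2 (j + 1) - q.2 j)) (by fun_prop) (by fun_prop)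
  set D : ℂ × ℝ → ℝ≥0∞ := fun q =>
    ENNReal.ofReal (4 / (L : ℝ) ^ 2) * ENNReal.ofReal (q.2 ^ 2) +
      ENNReal.ofReal (32 / P) * ENNReal.ofReal (‖q.1‖ ^ 2) with hD
  have hDm : Measurable D := by fun_prop
  have hprod : ∫⁻ ω, ENNReal.ofReal (‖X (k + 1) ω‖ ^ 2) * D (N j ω, W j ω) ∂μ =
      (∫⁻ ω, ENNReal.ofReal (‖X (k + 1) ω‖ ^ 2) ∂μ) * ∫⁻ ω, D (N j ω, W j ω) ∂μ :=
    lintegral_mul_eq_lintegral_mul_lintegral_of_indepFun (by fun_prop)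
      (hDm.comp ((mN j).prodMk (mW j)))
      (hindep.comp (φ := fun x : ℂ => ENNReal.ofReal (‖x‖ ^ 2)) (by fun_prop) hDm)
  calc ∫⁻ ω, ENNReal.ofReal (‖output L X N Θ ((k + 1) * L) ω - X (k + 1) ω * (1 / (L : ℂ)) *
      Complex.exp (Complex.I * (output L X N Θ j ω / X k ω).arg)‖ ^ 2) ∂μ
      ≤ ∫⁻ ω, (ENNReal.ofReal (‖X (k + 1) ω‖ ^ 2) * D (N j ω, W j ω) +
          ENNReal.ofReal 2 * ENNReal.ofReal (‖N ((k + 1) * L) ω‖ ^ 2)) ∂μ := by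
        refine lintegral_mono_ae ?_
        filter_upwards [h.input.ae_le_norm_sq k] with ω hω
        have o1 : output L X N Θ ((k + 1) * L) ω = X (k + 1) ω * (1 / (L : ℂ)) * Complex.exp
            (Complex.I * ((Θ j ω + W j ω : ℝ) : ℂ)) + N ((k + 1) * L) ω := by
          have := output_mul_add (X := X) (N := N) (Θ := Θ) (k + 1) ⟨0, hL⟩ ω
          simp only [add_zero] at this
          rw [this, hj1, h.phase.step]
        have o2 : output L X N Θ j ω =
            X k ω * (1 / (L : ℂ)) * Complex.exp (Complex.I * Θ j ω) + N j ω :=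
          output_mul_add (X := X) (N := N) (Θ := Θ) k ⟨L - 1, Nat.sub_lt hL one_pos⟩ ω
        rw [o1, o2, hD]
        simp only
        rw [← ENNReal.ofReal_mul (by positivity), ← ENNReal.ofReal_mul (by positivity),
          ← ENNReal.ofReal_add (by positivity) (by positivity),
          ← ENNReal.ofReal_mul (by positivity), ← ENNReal.ofReal_mul (by positivity),
          ← ENNReal.ofReal_add (by positivity) (by positivity)]
        exact ENNReal.ofReal_le_ofReal (norm_sample_sub_prediction_sq_le hL hP hω)
    _ ≤ ENNReal.ofReal (5 * P / 2) * (ENNReal.ofReal (4 / (L : ℝ) ^ 2) *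
          ENNReal.ofReal (2 * π * β * (1 / (L : ℝ))) +
          ENNReal.ofReal (32 / P) * ENNReal.ofReal v) + ENNReal.ofReal 2 * ENNReal.ofReal v := by
        have hDi : ∫⁻ ω, D (N j ω, W j ω) ∂μ = ENNReal.ofReal (4 / (L : ℝ) ^ 2) *
            ENNReal.ofReal (2 * π * β * (1 / (L : ℝ))) + ENNReal.ofReal (32 / P) *
            ENNReal.ofReal v := by
          simp only [hD]
          rw [lintegral_add_right _ (by fun_prop), lintegral_const_mul _ (by fun_prop),
            lintegral_const_mul _ (by fun_prop), hWsq, hNsq]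
        rw [lintegral_add_right _ (by fun_prop), hprod, hDi, lintegral_const_mul _ (by fun_prop),
          hNsq]
        gcongr
        exact h.input.lintegral_norm_sq_le hP _
    _ = _ := by
        rw [← ENNReal.ofReal_mul (by positivity), ← ENNReal.ofReal_mul (by positivity),
          ← ENNReal.ofReal_add (by positivity) (by positivity),
          ← ENNReal.ofReal_mul (by positivity), ← ENNReal.ofReal_mul (by positivity),
          ← ENNReal.ofReal_add (by positivity) (by positivity)]
        congr 1
        rw [hv]
        field_simp
        ring

end Channel

/-! ### The information rate -/

section Rate

open Real

variable {Ω : Type*} [MeasurableSpace Ω] {μ : Measure Ω} [IsProbabilityMeasure μ]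
  {β P σ2 : ℝ} {L : ℕ} {X N : ℕ → Ω → ℂ} {Θ W : ℕ → Ω → ℝ}

/-- The information rate exists and is finite, by Fekete's lemma. -/
lemma IsModel.exists_isInformationRate (h : IsModel μ β P σ2 L X N Θ W) (hP : 0 < P)
    (hσ : 0 < σ2) (hL : 0 < L) : ∃ r : ℝ≥0, IsInformationRate μ L X N Θ r := by
  obtain ⟨C, hC⟩ := h.exists_mutualInfo_le hP hσ hL
  set a : ℕ → ℝ≥0∞ := fun n => mutualInfo μ (inputBlock X n) (outputBlock L X N Θ n) with ha
  have hfin : ∀ n, a n ≠ ∞ := fun n => ((hC n).trans_lt ENNReal.ofReal_lt_top).ne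
  have hsub : Subadditive fun n => -(a n).toReal := fun n m => by
    have h1 := ENNReal.toReal_mono (hfin (n + m)) (h.mutualInfo_add_le hfin n m)
    rw [ENNReal.toReal_add (hfin n) (hfin m)] at h1
    linarith
  have hbdd : BddBelow (Set.range fun n : ℕ => -(a n).toReal / n) := by
    refine ⟨-(2 * |C|), ?_⟩
    rintro _ ⟨n, rfl⟩
    rcases n.eq_zero_or_pos with rfl | hn
    · simp
    · have hn' : (1 : ℝ) ≤ n := by exact_mod_cast hn
      have h1 : (a n).toReal ≤ |C| * (n + 1) :=
        ENNReal.toReal_le_of_le_ofReal (by positivity)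
          ((hC n).trans (ENNReal.ofReal_le_ofReal (by gcongr; exact le_abs_self C)))
      simp only
      rw [le_div_iff₀ (by linarith)]
      nlinarith [abs_nonneg C]
  have hlim := (hsub.tendsto_lim hbdd).neg
  have hlim' : Tendsto (fun n : ℕ => (a n).toReal / n) atTop (𝓝 (-hsub.lim)) := by
    refine hlim.congr fun n => ?_
    rw [neg_div, neg_neg]
  refine ⟨(-hsub.lim).toNNReal, ?_⟩
  refine (ENNReal.tendsto_ofReal hlim').congr' ?_
  filter_upwards [eventually_gt_atTop 0] with n hn
  rw [ENNReal.ofReal_div_of_pos (by exact_mod_cast hn), ENNReal.ofReal_toReal (hfin n),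
    ENNReal.ofReal_natCast]

/-- The bound on the mean of `exp (-metric)` under independence of symbol and observation. -/
noncomputable def mismatchBound (P σ2 : ℝ) (L : ℕ) : ℝ :=
  2 / P * √(2 * π * (P * σ2)) * (2 * √(σ2 * (1 / L)) / (√(P / 2) * (1 / L)))

/-- The bound on the mean of the metric over the channel. -/
noncomputable def metricBound (β P σ2 : ℝ) (L : ℕ) : ℝ :=
  (20 * P * σ2 + 194 * L * σ2 ^ 2) / (2 * (P * σ2)) +
    (20 * π * β * P / L ^ 3 + 82 * σ2 / L) / (2 * (σ2 * (1 / L)))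

/-- The metric of symbol `k + 1` in a block, with the energy estimated from the samples of that
symbol and the phase reference taken from the last sample of symbol `k`. -/
noncomputable def blockMetric (P σ2 : ℝ) {L m : ℕ} (hL : 0 < L) (k : Fin m)
    (q : (Fin (m + 1) → ℂ) × (Fin (m + 1) → Fin L → ℂ)) : ℝ :=
  metric L (P * σ2) (σ2 * (1 / L)) (energyEstimate σ2 (q.2 k.succ))
    (Complex.exp (Complex.I *
      (q.2 k.castSucc ⟨L - 1, Nat.sub_lt hL one_pos⟩ / q.1 k.castSucc).arg))
    (q.2 k.succ ⟨0, hL⟩) (q.1 k.succ)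

lemma measurable_blockMetric (P σ2 : ℝ) {L m : ℕ} (hL : 0 < L) (k : Fin m) :
    Measurable (blockMetric P σ2 hL k) := by
  unfold blockMetric
  refine measurable_metric _ _ _ ?_ (by fun_prop) (by fun_prop) (by fun_prop)
  exact (measurable_energyEstimate σ2).comp (by fun_prop)

lemma blockMetric_nonneg (hP : 0 < P) (hσ : 0 < σ2) {m : ℕ} (hL : 0 < L) (k : Fin m)
    (q : (Fin (m + 1) → ℂ) × (Fin (m + 1) → Fin L → ℂ)) : 0 ≤ blockMetric P σ2 hL k q :=
  metric_nonneg (by positivity) (by positivity) _ _ _ _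

lemma IsModel.lintegral_blockMetric_le (h : IsModel μ β P σ2 L X N Θ W) (hβ : 0 < β) (hP : 0 < P)
    (hσ : 0 < σ2) (hL : 0 < L) {m : ℕ} (k : Fin m) :
    ∫⁻ ω, ENNReal.ofReal (blockMetric P σ2 hL k
      (inputBlock X (m + 1) ω, outputBlock L X N Θ (m + 1) ω)) ∂μ ≤
      ENNReal.ofReal (metricBound β P σ2 L) := by
  have mO := h.measurable_output
  have mX := h.input.measurable
  have mB := h.measurable_outputBlock (m + 1)
  have m1 : Measurable fun ω => ENNReal.ofReal
      ((energyEstimate σ2 (outputBlock L X N Θ (m + 1) ω k.succ) - ‖X (k + 1) ω‖ ^ 2) ^ 2) := by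
    have : Measurable fun ω => energyEstimate σ2 (outputBlock L X N Θ (m + 1) ω k.succ) :=
      (measurable_energyEstimate σ2).comp ((measurable_pi_apply k.succ).comp mB)
    fun_prop
  calc ∫⁻ ω, ENNReal.ofReal (blockMetric P σ2 hL k
      (inputBlock X (m + 1) ω, outputBlock L X N Θ (m + 1) ω)) ∂μ
      = ∫⁻ ω, (ENNReal.ofReal (2 * (P * σ2))⁻¹ * ENNReal.ofReal
            ((energyEstimate σ2 (outputBlock L X N Θ (m + 1) ω k.succ) - ‖X (k + 1) ω‖ ^ 2) ^ 2) +
          ENNReal.ofReal (2 * (σ2 * (1 / (L : ℝ))))⁻¹ * ENNReal.ofReal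
            (‖output L X N Θ ((k + 1) * L) ω - X (k + 1) ω * (1 / (L : ℂ)) * Complex.exp
              (Complex.I * (output L X N Θ (k * L + (L - 1)) ω / X k ω).arg)‖ ^ 2)) ∂μ := by
        refine lintegral_congr fun ω => ?_
        rw [← ENNReal.ofReal_mul (by positivity), ← ENNReal.ofReal_mul (by positivity),
          ← ENNReal.ofReal_add (by positivity) (by positivity), blockMetric, metric,
          div_eq_inv_mul, div_eq_inv_mul _ (2 * (σ2 * (1 / (L : ℝ))))]
        rfl
    _ ≤ ENNReal.ofReal (2 * (P * σ2))⁻¹ * ENNReal.ofReal (20 * P * σ2 + 194 * L * σ2 ^ 2) +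
          ENNReal.ofReal (2 * (σ2 * (1 / (L : ℝ))))⁻¹ *
            ENNReal.ofReal (20 * π * β * P / L ^ 3 + 82 * σ2 / L) := by
        rw [lintegral_add_left (m1.const_mul _), lintegral_const_mul _ m1,
          lintegral_const_mul _ (by fun_prop)]
        gcongr
        · exact h.lintegral_energy_sub_sq_le hP hσ hL (m + 1) k.succ
        · exact h.lintegral_sample_sub_prediction_sq_le hβ hP hσ hL k
    _ = ENNReal.ofReal (metricBound β P σ2 L) := by
        rw [← ENNReal.ofReal_mul (by positivity), ← ENNReal.ofReal_mul (by positivity),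
          ← ENNReal.ofReal_add (by positivity) (by positivity), metricBound, inv_mul_eq_div,
          inv_mul_eq_div]

/-- The block mutual information is at least the mean of minus the metric, corrected by its
exponential mean under independence, for every symbol of the block but the first. -/
lemma IsModel.le_mutualInfo (h : IsModel μ β P σ2 L X N Θ W) (hβ : 0 < β) (hP : 0 < P)
    (hσ : 0 < σ2) (hL : 0 < L) (m : ℕ) :
    ENNReal.ofReal (m * (-log (mismatchBound P σ2 L) - metricBound β P σ2 L)) ≤
      mutualInfo μ (inputBlock X (m + 1)) (outputBlock L X N Θ (m + 1)) := by
  set κ : ℝ := mismatchBound P σ2 L with hκdef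
  have hκ : 0 < κ := by
    rw [hκdef, mismatchBound]
    positivity
  set D : ℝ := metricBound β P σ2 L with hDdef
  have hD : 0 ≤ D := by
    rw [hDdef, metricBound]
    positivity
  have hA := h.measurable_inputBlock (m + 1)
  have hB := h.measurable_outputBlock (m + 1)
  have := Measure.isProbabilityMeasure_map (μ := μ) hA.aemeasurable
  have := Measure.isProbabilityMeasure_map (μ := μ) hB.aemeasurable
  have := Measure.isProbabilityMeasure_map (μ := μ) (hA.prodMk hB).aemeasurable
  have hM := fun k : Fin m => measurable_blockMetric P σ2 hL k
  set f : (Fin (m + 1) → ℂ) × (Fin (m + 1) → Fin L → ℂ) → ℝ := fun q =>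
    ∑ k : Fin m, (-blockMetric P σ2 hL k q - log κ) with hf
  set R : (Fin (m + 1) → ℂ) × (Fin (m + 1) → Fin L → ℂ) → ℝ≥0∞ := fun q =>
    ∏ k : Fin m, ENNReal.ofReal (rexp (-blockMetric P σ2 hL k q)) * ENNReal.ofReal κ⁻¹ with hR
  have hfm : Measurable f := by fun_prop
  have hRm : Measurable R := by fun_prop
  have hint : ∀ k : Fin m, Integrable (fun ω => blockMetric P σ2 hL k
      (inputBlock X (m + 1) ω, outputBlock L X N Θ (m + 1) ω)) μ := fun k =>
    (lintegral_ofReal_ne_top_iff_integrable ((hM k).comp (hA.prodMk hB)).aestronglyMeasurable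
      (ae_of_all _ fun _ => blockMetric_nonneg hP hσ hL k _)).1
      ((h.lintegral_blockMetric_le hβ hP hσ hL k).trans_lt ENNReal.ofReal_lt_top).ne
  have hmean : ∀ k : Fin m, ∫ ω, blockMetric P σ2 hL k
      (inputBlock X (m + 1) ω, outputBlock L X N Θ (m + 1) ω) ∂μ ≤ D := fun k => by
    rw [integral_eq_lintegral_of_nonneg_ae
      (ae_of_all _ fun _ => blockMetric_nonneg hP hσ hL k _) (hint k).aestronglyMeasurable]
    exact ENNReal.toReal_le_of_le_ofReal hD (h.lintegral_blockMetric_le hβ hP hσ hL k)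
  have hi : ∀ k : Fin m, Integrable (fun ω => -blockMetric P σ2 hL k
      (inputBlock X (m + 1) ω, outputBlock L X N Θ (m + 1) ω)) μ := fun k => (hint k).neg
  have hi' : ∀ k : Fin m, Integrable (fun ω => -blockMetric P σ2 hL k
      (inputBlock X (m + 1) ω, outputBlock L X N Θ (m + 1) ω) - log κ) μ := fun k =>
    (hi k).sub (integrable_const _)
  have hfint : Integrable f (μ.map fun ω =>
      (inputBlock X (m + 1) ω, outputBlock L X N Θ (m + 1) ω)) := by
    rw [integrable_map_measure hfm.aestronglyMeasurable (hA.prodMk hB).aemeasurable]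
    exact integrable_finsetSum _ fun k _ => hi' k
  -- Under independence the outputs may be held fixed while the symbols are integrated out.
  have hRQ : ∫⁻ q, R q ∂((μ.map (inputBlock X (m + 1))).prod
      (μ.map (outputBlock L X N Θ (m + 1)))) ≤ 1 := by
    rw [lintegral_prod_symm' _ hRm]
    have hy : ∀ y, ∫⁻ x, R (x, y) ∂μ.map (inputBlock X (m + 1)) ≤ 1 := by
      intro y
      have hRy : Measurable fun x => R (x, y) := hRm.comp measurable_prodMk_right
      rw [lintegral_map hRy hA]
      set g : Fin m → ℂ → ℂ → ℝ≥0∞ := fun k x' x => ENNReal.ofReal (rexp (-metric L (P * σ2)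
        (σ2 * (1 / L)) (energyEstimate σ2 (y k.succ)) (Complex.exp (Complex.I *
          (y k.castSucc ⟨L - 1, Nat.sub_lt hL one_pos⟩ / x').arg)) (y k.succ ⟨0, hL⟩) x)) *
        ENNReal.ofReal κ⁻¹ with hg
      refine (lintegral_prod_consecutive_le h.input.measurable h.input.iIndep (κ := 1) m g
        (fun k => by fun_prop) fun k x' => ?_).trans (by simp)
      have hXm := h.input.measurable (k + 1)
      calc ∫⁻ ω, g k x' (X (k + 1) ω) ∂μ ≤ ENNReal.ofReal κ * ENNReal.ofReal κ⁻¹ := by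
            simp only [hg]
            rw [lintegral_mul_const _ (by fun_prop)]
            gcongr
            exact h.input.lintegral_exp_neg_metric_le hP hL (by positivity) (by positivity) _
              (Complex.norm_exp_I_mul_ofReal _) _ _
        _ = 1 := by
            rw [← ENNReal.ofReal_mul hκ.le, mul_inv_cancel₀ hκ.ne', ENNReal.ofReal_one]
    calc _ ≤ ∫⁻ _, 1 ∂μ.map (outputBlock L X N Θ (m + 1)) := lintegral_mono hy
      _ = 1 := by simp
  refine le_trans (ENNReal.ofReal_le_ofReal ?_)
    (ofReal_integral_le_klDiv hRm hRQ hfint (ae_of_all _ fun q => ?_))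
  · rw [integral_map (hA.prodMk hB).aemeasurable hfm.aestronglyMeasurable]
    simp only [hf]
    rw [integral_finsetSum _ fun k _ => hi' k]
    calc (m : ℝ) * (-log κ - D) = ∑ _k : Fin m, (-D - log κ) := by
          rw [Finset.sum_const, Finset.card_univ, Fintype.card_fin, nsmul_eq_mul]
          ring
      _ ≤ _ := by
          refine Finset.sum_le_sum fun k _ => ?_
          rw [integral_sub (hi k) (integrable_const _), integral_neg]
          simp only [integral_const, probReal_univ, smul_eq_mul, one_mul]
          linarith [hmean k]
  · simp only [hf, hR]
    rw [exp_sum, ENNReal.ofReal_prod_of_nonneg fun k _ => (exp_pos _).le]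
    refine (Finset.prod_congr rfl fun k _ => ?_).le
    rw [exp_sub, exp_log hκ, div_eq_mul_inv, ENNReal.ofReal_mul (exp_pos _).le]

/-- In a block of `m + 1` symbols the bound holds for `m` of them, which makes no difference in the
limit. -/
lemma IsModel.le_informationRate (h : IsModel μ β P σ2 L X N Θ W) (hβ : 0 < β) (hP : 0 < P)
    (hσ : 0 < σ2) (hL : 0 < L) {r : ℝ≥0} (hr : IsInformationRate μ L X N Θ r) :
    -log (mismatchBound P σ2 L) - metricBound β P σ2 L ≤ r := by
  obtain ⟨C, hC⟩ := h.exists_mutualInfo_le hP hσ hL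
  set t : ℝ := -log (mismatchBound P σ2 L) - metricBound β P σ2 L
  have hr' := (ENNReal.tendsto_toReal ENNReal.coe_ne_top).comp hr
  rw [ENNReal.coe_toReal] at hr'
  have hr'' := hr'.comp (tendsto_add_atTop_nat 1)
  have ht : Tendsto (fun m : ℕ => (m : ℝ) / (m + 1) * t) atTop (𝓝 (1 * t)) :=
    tendsto_natCast_div_add_atTop (1 : ℝ) |>.mul_const t
  rw [one_mul] at ht
  refine le_of_tendsto_of_tendsto' ht hr'' fun m => ?_
  have hfin : mutualInfo μ (inputBlock X (m + 1)) (outputBlock L X N Θ (m + 1)) ≠ ∞ :=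
    ((hC _).trans_lt ENNReal.ofReal_lt_top).ne
  have hle := (ENNReal.ofReal_le_iff_le_toReal hfin).1 (h.le_mutualInfo hβ hP hσ hL m)
  simp only [Function.comp_apply, ENNReal.toReal_div, ENNReal.toReal_natCast]
  push_cast
  rw [div_mul_eq_mul_div]
  gcongr

end Rate

/-! ### High signal-to-noise ratio -/

section HighSNR

open Real

variable {β snr P σ2 : ℝ}

lemma samplesPerSymbol_pos (hβ : 0 < β) (hsnr : 0 < snr) : 0 < samplesPerSymbol β snr :=
  Nat.ceil_pos.2 (mul_pos hβ (sqrt_pos.2 hsnr))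

lemma le_samplesPerSymbol : β * √snr ≤ samplesPerSymbol β snr := Nat.le_ceil _

lemma samplesPerSymbol_le (hβ : 0 < β) (hsnr : 1 ≤ snr) :
    (samplesPerSymbol β snr : ℝ) ≤ (β + 1) * √snr := by
  have h1 : (samplesPerSymbol β snr : ℝ) < β * √snr + 1 :=
    Nat.ceil_lt_add_one (mul_nonneg hβ.le (sqrt_nonneg _))
  have h2 : 1 ≤ √snr := one_le_sqrt.2 hsnr
  linarith

/-- The energy window contributes a factor `snr ^ (-1/2)` to the mismatch bound. The phase window
contributes a factor `snr ^ (-1/4)`, since `L` is of the order of `√snr`. -/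
lemma log_mismatchBound_le (hβ : 0 < β) (hsnr : 1 ≤ snr) (hP : 0 < P) (hσ : 0 < σ2)
    (hPσ : P / σ2 = snr) : log (mismatchBound P σ2 (samplesPerSymbol β snr)) ≤
      1 / 2 * log (64 * π * (β + 1)) - 3 / 4 * log snr := by
  have hsnr0 : 0 < snr := by linarith
  have hLpos : (0 : ℝ) < samplesPerSymbol β snr := by exact_mod_cast samplesPerSymbol_pos hβ hsnr0
  have hLle := samplesPerSymbol_le hβ hsnr
  set L := samplesPerSymbol β snr
  have hκ : 0 < mismatchBound P σ2 L := by
    rw [mismatchBound]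
    positivity
  have hsq : mismatchBound P σ2 L ^ 2 = 64 * π * L / snr ^ 2 := by
    rw [mismatchBound, mul_pow, mul_pow, div_pow (2 * √(σ2 * (1 / (L : ℝ)))), mul_pow, mul_pow,
      sq_sqrt (by positivity), sq_sqrt (by positivity), sq_sqrt (by positivity), ← hPσ]
    field_simp
    norm_num
  have h1 : log (mismatchBound P σ2 L ^ 2) ≤ log (64 * π * ((β + 1) * √snr) / snr ^ 2) := by
    rw [hsq]
    refine log_le_log (by positivity) ?_
    gcongr
  have h2 : log (64 * π * ((β + 1) * √snr) / snr ^ 2) =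
      log (64 * π * (β + 1)) + 1 / 2 * log snr - 2 * log snr := by
    rw [log_div (by positivity) (by positivity), ← mul_assoc, log_mul (by positivity)
      (by positivity), log_sqrt hsnr0.le, log_pow]
    push_cast
    ring
  rw [h2, log_pow] at h1
  push_cast at h1
  linarith

/-- The mean of the metric stays bounded because `L` is of the order of `√snr`, from above for the
additive noise in the energy estimate and from below for the phase increment. -/
lemma metricBound_le (hβ : 0 < β) (hsnr : 1 ≤ snr) (hP : 0 < P) (hσ : 0 < σ2)
    (hPσ : P / σ2 = snr) : metricBound β P σ2 (samplesPerSymbol β snr) ≤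
      10 + 97 * (β + 1) + (10 * π / β + 41) := by
  have hsnr0 : 0 < snr := by linarith
  have hLpos : (0 : ℝ) < samplesPerSymbol β snr := by exact_mod_cast samplesPerSymbol_pos hβ hsnr0
  have hLle := samplesPerSymbol_le hβ hsnr
  have hLge := le_samplesPerSymbol (β := β) (snr := snr)
  set L := samplesPerSymbol β snr
  have hPe : P = snr * σ2 := by rw [← hPσ]; field_simp
  have e : metricBound β P σ2 L = 10 + 97 * (L / snr) + (10 * π * β * (snr / L ^ 2) + 41) := by
    rw [metricBound, hPe]
    field_simp
    ring
  have hs : √snr ≤ snr := sqrt_le_iff.2 ⟨hsnr0.le, by nlinarith⟩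
  have h1 : (L : ℝ) / snr ≤ β + 1 := by
    rw [div_le_iff₀ hsnr0]
    exact hLle.trans (by gcongr)
  have h2 : snr / (L : ℝ) ^ 2 ≤ 1 / β ^ 2 := by
    rw [div_le_div_iff₀ (by positivity) (by positivity), one_mul]
    calc snr * β ^ 2 = (β * √snr) ^ 2 := by rw [mul_pow, sq_sqrt hsnr0.le]; ring
      _ ≤ (L : ℝ) ^ 2 := by gcongr
  rw [e]
  calc 10 + 97 * (L / snr) + (10 * π * β * (snr / L ^ 2) + 41)
      ≤ 10 + 97 * (β + 1) + (10 * π * β * (1 / β ^ 2) + 41) := by gcongr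
    _ = _ := by field_simp

end HighSNR

end WienerPhaseNoise

theorem mainTheorem1 (β : ℝ) (hβ : 0 < β) :
    ∃ c : ℝ,
      ∀ (Ω : ℝ → Type*) [∀ snr, MeasurableSpace (Ω snr)] (μ : ∀ snr, Measure (Ω snr))
        [∀ snr, IsProbabilityMeasure (μ snr)] (P σ2 : ℝ → ℝ)
        (X N : ∀ snr, ℕ → Ω snr → ℂ) (Θ W : ∀ snr, ℕ → Ω snr → ℝ),
        (∀ snr, 0 < snr → 0 < P snr ∧ 0 < σ2 snr ∧ P snr / σ2 snr = snr ∧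
          WienerPhaseNoise.IsModel (μ snr) β (P snr) (σ2 snr)
            (WienerPhaseNoise.samplesPerSymbol β snr) (X snr) (N snr) (Θ snr) (W snr)) →
        ∃ R : ℝ → ℝ≥0,
          (∀ snr, 0 < snr →
            WienerPhaseNoise.IsInformationRate (μ snr)
              (WienerPhaseNoise.samplesPerSymbol β snr) (X snr) (N snr) (Θ snr) (R snr)) ∧
          (c : EReal) ≤
            liminf (fun snr : ℝ => (((R snr : ℝ) - 3 / 4 * Real.log snr : ℝ) : EReal)) atTop := by
  refine ⟨-(1 / 2 * Real.log (64 * Real.pi * (β + 1))) -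
    (10 + 97 * (β + 1) + (10 * Real.pi / β + 41)), ?_⟩
  intro Ω _ μ _ P σ2 X N Θ W h
  have hex : ∀ snr, ∃ r : ℝ≥0, 0 < snr → WienerPhaseNoise.IsInformationRate (μ snr)
      (WienerPhaseNoise.samplesPerSymbol β snr) (X snr) (N snr) (Θ snr) r := by
    intro snr
    by_cases hsnr : 0 < snr
    · obtain ⟨hP, hσ, -, hM⟩ := h snr hsnr
      obtain ⟨r, hr⟩ := hM.exists_isInformationRate hP hσ
        (WienerPhaseNoise.samplesPerSymbol_pos hβ hsnr)
      exact ⟨r, fun _ => hr⟩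
    · exact ⟨0, fun h0 => absurd h0 hsnr⟩
  choose R hR using hex
  refine ⟨R, hR, le_liminf_of_le (by isBoundedDefault) ?_⟩
  filter_upwards [eventually_ge_atTop 1] with snr hsnr
  have hsnr0 : 0 < snr := by linarith
  obtain ⟨hP, hσ, hPσ, hM⟩ := h snr hsnr0
  have h1 := hM.le_informationRate hβ hP hσ (WienerPhaseNoise.samplesPerSymbol_pos hβ hsnr0)
    (hR snr hsnr0)
  have h2 := WienerPhaseNoise.log_mismatchBound_le hβ hsnr hP hσ hPσ
  have h3 := WienerPhaseNoise.metricBound_le hβ hsnr hP hσ hPσ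
  exact EReal.coe_le_coe_iff.2 (by linarith)
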